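/- Let $R$ and $S$ be associative rings with unit (not necessarily commutative), let $n$ be a positive integer, and let $C={}_SC_R$ be a faithfully semidualizing $(S,R)$-bimodule. Modules are left modules unless stated otherwise, and right $R$-modules are called $R^{op}$-modules. Definitions. - A module $M$ is finitely $n$-presented if there is an exact sequence $F_n\to\cdots\to F_1\to F_0\to M\to 0$ with every $F_i$ finitely generated and free. - $C$ is semidualizing if: ${}_SC$ and $C_R$ each admit a resolution by finitely generated projective modules; the homothety maps $S\to\operatorname{Hom}_{R^{op}}(C,C)$, $s\mapsto(c\mapsto sc)$, and $R\to\operatorname{Hom}_S(C,C)$, $r\mapsto(c\mapsto cr)$, are isomorphisms; and $\operatorname{Ext}_S^i(C,C)=0=\operatorname{Ext}_{R^{op}}^i(C,C)$ for all $i\ge 1$. It is faithfully semidualizing if, moreover, for every left $S$-module $N$ and every right $R$-module $M$, $\operatorname{Hom}_S(C,N)=0$ implies $N=0$, and $\operatorname{Hom}_{R^{op}}(C,M)=0$ implies $M=0$. - Let $A$ be a ring. A left $A$-module $M$ is $fp_n$-injective if for every injective homomorphism $K\to L$ of finitely $n$-presented left $A$-modules the map $\operatorname{Hom}_A(L,M)\to\operatorname{Hom}_A(K,M)$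 is surjective. It is $fp_n$-flat if for every injective homomorphism $K\to L$ of finitely $n$-presented right $A$-modules the map $K\otimes_AM\to L\otimes_AM$ is injective. - A left $R$-module is $C$-$fp_n$-injective if it is isomorphic to $\operatorname{Hom}_S(C,X)$ for some $fp_n$-injective left $S$-module $X$. A left $S$-module is $C$-$fp_n$-flat if it is isomorphic to $C\otimes_RY$ for some $fp_n$-flat left $R$-module $Y$. - The $fp_n$-injective dimension $\operatorname{fp_n.id}_A(M)$ (resp., for $A=R$, the $C$-$fp_n$-injective dimension $\operatorname{Cfp_n.id}_R(M)$) is the least integer $k\ge 0$ for which there is an exact sequence $0\to M\to I_0\to I_1\to\cdots\to I_k\to 0$ with every $I_i$ $fp_n$-injective (resp. $C$-$fp_n$-injective), and $\infty$ if there is no such $k$. The $fp_n$-flat dimension $\operatorname{fp_n.fd}_A(M)$ (resp., for $A=S$, the $C$-$fp_n$-flat dimension $\operatorname{Cfp_n.fd}_S(M)$) is the least integer $k\ge 0$ for which there is an exact sequence $0\to F_k\to\cdots\to F_1\to F_0\to M\to 0$ with every $F_i$ $fp_n$-flat (resp. $C$-$fp_n$-flat), and $\infty$ if there is no such $k$.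 Proposition. For every left $R$-module $M$ and every left $S$-module $N$, the following equalities hold in $\{0,1,2,\dots\}\cup\{\infty\}$: 1. $\operatorname{fp_n.id}_S(N)=\operatorname{Cfp_n.id}_R(\operatorname{Hom}_S(C,N))$; 2. $\operatorname{fp_n.fd}_R(M)=\operatorname{Cfp_n.fd}_S(C\otimes_RM)$; 3. $\operatorname{Cfp_n.id}_R(M)=\operatorname{fp_n.id}_S(C\otimes_RM)$; 4. $\operatorname{Cfp_n.fd}_S(N)=\operatorname{fp_n.fd}_R(\operatorname{Hom}_S(C,N))$. -/

import Mathlib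

open scoped TensorProduct

universe u

namespace FpDim

section Tensor

/-! Rings are associative with unit and not necessarily commutative. Modules are left modules; a right
`R`-module is a module over `Rᵐᵒᵖ`, with `c r` written `MulOpposite.op r • c`. An `(S, R)`-bimodule is
an abelian group with commuting `S`- and `Rᵐᵒᵖ`-module structures. -/

variable (S R : Type u) [Ring S] [Ring R]

/-- The relations `(c r) ⊗ m - c ⊗ (r m)` in the tensor product over `ℤ` of a right `R`-module `C`
and a left `R`-module `M`. -/
def balancedRel (C M : Type u) [AddCommGroup C] [Module Rᵐᵒᵖ C] [AddCommGroup M] [Module R M] :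
    Set (C ⊗[ℤ] M) :=
  {x | ∃ (c : C) (r : R) (m : M), x = (MulOpposite.op r • c) ⊗ₜ[ℤ] m - c ⊗ₜ[ℤ] (r • m)}

/-- The subgroup generated by the relations `(c r) ⊗ m - c ⊗ (r m)`; it is stable under any ring `A`
that acts on `C` from the left and commutes with the right action of `R`. -/
def balancedSubmodule (A : Type*) [Ring A] (C M : Type u) [AddCommGroup C] [Module A C]
    [Module Rᵐᵒᵖ C] [SMulCommClass A Rᵐᵒᵖ C] [AddCommGroup M] [Module R M] :
    Submodule A (C ⊗[ℤ] M) where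
  toAddSubmonoid := (AddSubgroup.closure (balancedRel R C M)).toAddSubmonoid
  smul_mem' a x hx := by
    change x ∈ AddSubgroup.closure (balancedRel R C M) at hx
    change a • x ∈ AddSubgroup.closure (balancedRel R C M)
    induction hx using AddSubgroup.closure_induction with
    | mem x hx =>
      obtain ⟨c, r, m, rfl⟩ := hx
      refine AddSubgroup.subset_closure ⟨a • c, r, m, ?_⟩
      rw [smul_sub, TensorProduct.smul_tmul', TensorProduct.smul_tmul', smul_comm]
    | zero => rw [smul_zero]; exact AddSubgroup.zero_mem _
    | add x y _ _ hx hy => rw [smul_add]; exact AddSubgroup.add_mem _ hx hy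
    | neg x _ hx => rw [smul_neg]; exact AddSubgroup.neg_mem _ hx

/-- The tensor product `C ⊗_R M` of a right `R`-module `C` and a left `R`-module `M` over the (not
necessarily commutative) ring `R`, as an `A`-module for an `(A, R)`-bimodule `C`.
As an abelian group it does not depend on `A`; for a mere right `R`-module take `A = ℤ`. -/
abbrev BTensor (A : Type*) [Ring A] (C M : Type u) [AddCommGroup C] [Module A C]
    [Module Rᵐᵒᵖ C] [SMulCommClass A Rᵐᵒᵖ C] [AddCommGroup M] [Module R M] : Type u :=
  (C ⊗[ℤ] M) ⧸ balancedSubmodule R A C M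

/-- The map `K ⊗_R M → L ⊗_R M` of abelian groups induced by a map `K → L` of right `R`-modules. -/
def bTensorMap {K L : Type u} [AddCommGroup K] [Module Rᵐᵒᵖ K] [AddCommGroup L] [Module Rᵐᵒᵖ L]
    (M : Type u) [AddCommGroup M] [Module R M] (i : K →ₗ[Rᵐᵒᵖ] L) :
    BTensor R ℤ K M →ₗ[ℤ] BTensor R ℤ L M :=
  Submodule.mapQ _ _ (LinearMap.rTensor M i.toAddMonoidHom.toIntLinearMap) (by
    intro x hx
    change x ∈ AddSubgroup.closure (balancedRel R K M) at hx
    change LinearMap.rTensor M i.toAddMonoidHom.toIntLinearMap x ∈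
      AddSubgroup.closure (balancedRel R L M)
    induction hx using AddSubgroup.closure_induction with
    | mem x hx =>
      obtain ⟨c, r, m, rfl⟩ := hx
      refine AddSubgroup.subset_closure ⟨i c, r, m, ?_⟩
      simp
    | zero => rw [map_zero]; exact AddSubgroup.zero_mem _
    | add x y _ _ hx hy => rw [map_add]; exact AddSubgroup.add_mem _ hx hy
    | neg x _ hx => rw [map_neg]; exact AddSubgroup.neg_mem _ hx)

/-- Right multiplication `c ↦ c r` by `r : R` on an `(S, R)`-bimodule `C`, as an `S`-linear map. -/
def rightMul (C : Type u) [AddCommGroup C] [Module S C] [Module Rᵐᵒᵖ C] [SMulCommClass S Rᵐᵒᵖ C]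
    (r : R) : C →ₗ[S] C where
  toFun c := MulOpposite.op r • c
  map_add' := smul_add _
  map_smul' s c := (smul_comm s (MulOpposite.op r) c).symm

/-- Left multiplication `c ↦ s c` by `s : S` on an `(S, R)`-bimodule `C`, as a map of right
`R`-modules. -/
def leftMul (C : Type u) [AddCommGroup C] [Module S C] [Module Rᵐᵒᵖ C] [SMulCommClass S Rᵐᵒᵖ C]
    (s : S) : C →ₗ[Rᵐᵒᵖ] C where
  toFun c := s • c
  map_add' := smul_add _
  map_smul' r c := smul_comm s r c

/-- `Hom_S(C, X)` for left `S`-modules `C` and `X`. It is a separate name for `C →ₗ[S] X`, so that its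
`R`-module structure for an `(S, R)`-bimodule `C` cannot be confused with another one. -/
def BHom (C X : Type u) [AddCommGroup C] [Module S C] [AddCommGroup X] [Module S X] : Type u :=
  C →ₗ[S] X

instance BHom.addCommGroup (C X : Type u) [AddCommGroup C] [Module S C] [AddCommGroup X] [Module S X] :
    AddCommGroup (BHom S C X) :=
  inferInstanceAs (AddCommGroup (C →ₗ[S] X))

/-- The left `R`-module structure on `Hom_S(C, X)` for an `(S, R)`-bimodule `C`: `(r f)(c) = f(c r)`. -/
instance BHom.module (C X : Type u) [AddCommGroup C] [Module S C] [Module Rᵐᵒᵖ C] [SMulCommClass S Rᵐᵒᵖ C]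
    [AddCommGroup X] [Module S X] : Module R (BHom S C X) where
  smul r f := LinearMap.comp (show C →ₗ[S] X from f) (rightMul S R C r)
  one_smul f := LinearMap.ext fun c => congrArg (show C →ₗ[S] X from f) (one_smul Rᵐᵒᵖ c)
  mul_smul r s f := LinearMap.ext fun c => congrArg (show C →ₗ[S] X from f)
    (mul_smul (MulOpposite.op s) (MulOpposite.op r) c)
  smul_zero _ := rfl
  smul_add _ _ _ := rfl
  add_smul r s f := LinearMap.ext fun c =>
    (congrArg (show C →ₗ[S] X from f) (add_smul (MulOpposite.op r) (MulOpposite.op s) c)).trans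
      (map_add (show C →ₗ[S] X from f) _ _)
  zero_smul f := LinearMap.ext fun c =>
    (congrArg (show C →ₗ[S] X from f) (zero_smul Rᵐᵒᵖ c)).trans (map_zero (show C →ₗ[S] X from f))

end Tensor

section Finiteness

/-- `M` is finitely `n`-presented: there is an exact sequence `F_n → ⋯ → F_1 → F_0 → M → 0` with
`F_0, …, F_n` finitely generated free. (`F i` for `i > n` and `d i` for `i ≥ n` play no role.) -/
def FinitelyNPresented (A : Type u) [Ring A] (n : ℕ) (M : Type u) [AddCommGroup M] [Module A M] :
    Prop :=
  ∃ (F : ℕ → ModuleCat.{u} A) (d : ∀ i, F (i + 1) →ₗ[A] F i) (ε : F 0 →ₗ[A] M),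
    (∀ i ≤ n, Module.Free A (F i) ∧ Module.Finite A (F i)) ∧
    Function.Surjective ε ∧
    (1 ≤ n → Function.Exact (d 0) ε) ∧
    ∀ i, i + 2 ≤ n → Function.Exact (d (i + 1)) (d i)

/-- `M` admits a degreewise finite projective resolution
`⋯ → P_1 → P_0 → M → 0`, every `P_i` being finitely generated projective. -/
def HasDegreewiseFiniteResolution (A : Type u) [Ring A] (M : Type u) [AddCommGroup M]
    [Module A M] : Prop :=
  ∃ (P : ℕ → ModuleCat.{u} A) (d : ∀ i, P (i + 1) →ₗ[A] P i) (ε : P 0 →ₗ[A] M),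
    (∀ i, Module.Projective A (P i) ∧ Module.Finite A (P i)) ∧
    Function.Surjective ε ∧
    Function.Exact (d 0) ε ∧
    ∀ i, Function.Exact (d (i + 1)) (d i)

end Finiteness

section Semidualizing

variable (S R : Type u) [Ring S] [Ring R] (C : Type u) [AddCommGroup C] [Module S C]
  [Module Rᵐᵒᵖ C] [SMulCommClass S Rᵐᵒᵖ C]

/-- The `(S, R)`-bimodule `C` is semidualizing. -/
structure IsSemidualizing : Prop where
  left_resolution : HasDegreewiseFiniteResolution S C
  right_resolution : HasDegreewiseFiniteResolution Rᵐᵒᵖ C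
  /-- the homothety map `S → Hom_{Rᵒᵖ}(C, C)`, `s ↦ (c ↦ s c)`, is an isomorphism -/
  left_homothety : Function.Bijective (leftMul S R C)
  /-- the homothety map `R → Hom_S(C, C)`, `r ↦ (c ↦ c r)`, is an isomorphism -/
  right_homothety : Function.Bijective (rightMul S R C)
  left_ext : ∀ i : ℕ, 1 ≤ i →
    Subsingleton (CategoryTheory.Abelian.Ext.{u} (ModuleCat.of S C) (ModuleCat.of S C) i)
  right_ext : ∀ i : ℕ, 1 ≤ i →
    Subsingleton (CategoryTheory.Abelian.Ext.{u} (ModuleCat.of Rᵐᵒᵖ C) (ModuleCat.of Rᵐᵒᵖ C) i)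

/-- The `(S, R)`-bimodule `C` is faithfully semidualizing: it is semidualizing, and for a left
`S`-module `N` (resp. a right `R`-module `M`) with `Hom_S(C, N) = 0` (resp. `Hom_{Rᵒᵖ}(C, M) = 0`)
one has `N = 0` (resp. `M = 0`). -/
structure IsFaithfullySemidualizing : Prop extends IsSemidualizing S R C where
  left_faithful : ∀ (N : Type u) [AddCommGroup N] [Module S N],
    Subsingleton (C →ₗ[S] N) → Subsingleton N
  right_faithful : ∀ (M : Type u) [AddCommGroup M] [Module Rᵐᵒᵖ M],
    Subsingleton (C →ₗ[Rᵐᵒᵖ] M) → Subsingleton M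

end Semidualizing

section Classes

/-- `M` is an `fp_n`-injective left `A`-module: for every injection `K → L` of finitely `n`-presented
`A`-modules, `Hom_A(L, M) → Hom_A(K, M)` is surjective. -/
def IsFpInjective (n : ℕ) (A : Type u) [Ring A] (M : Type u) [AddCommGroup M] [Module A M] : Prop :=
  ∀ (K L : Type u) [AddCommGroup K] [AddCommGroup L] [Module A K] [Module A L] (i : K →ₗ[A] L),
    FinitelyNPresented A n K → FinitelyNPresented A n L → Function.Injective i →
      Function.Surjective (fun g : L →ₗ[A] M => g ∘ₗ i)

/-- `M` is an `fp_n`-flat left `A`-module: for every injection `K → L` of finitely `n`-presented right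
`A`-modules, `K ⊗_A M → L ⊗_A M` is injective. -/
def IsFpFlat (n : ℕ) (A : Type u) [Ring A] (M : Type u) [AddCommGroup M] [Module A M] : Prop :=
  ∀ (K L : Type u) [AddCommGroup K] [AddCommGroup L] [Module Aᵐᵒᵖ K] [Module Aᵐᵒᵖ L]
    (i : K →ₗ[Aᵐᵒᵖ] L),
    FinitelyNPresented Aᵐᵒᵖ n K → FinitelyNPresented Aᵐᵒᵖ n L → Function.Injective i →
      Function.Injective (bTensorMap A M i)

variable (n : ℕ) (S R : Type u) [Ring S] [Ring R] (C : Type u) [AddCommGroup C] [Module S C]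
  [Module Rᵐᵒᵖ C] [SMulCommClass S Rᵐᵒᵖ C]

/-- The left `R`-module `M` is `C`-`fp_n`-injective: it is (isomorphic to) `Hom_S(C, X)` for some
`fp_n`-injective left `S`-module `X`. -/
def IsCFpInjective (M : Type u) [AddCommGroup M] [Module R M] : Prop :=
  ∃ X : ModuleCat.{u} S, IsFpInjective n S X ∧ Nonempty (M ≃ₗ[R] BHom S C X)

/-- The left `S`-module `N` is `C`-`fp_n`-flat: it is (isomorphic to) `C ⊗_R Y` for some `fp_n`-flat
left `R`-module `Y`. -/
def IsCFpFlat (N : Type u) [AddCommGroup N] [Module S N] : Prop :=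
  ∃ Y : ModuleCat.{u} R, IsFpFlat n R Y ∧ Nonempty (N ≃ₗ[S] BTensor R S C Y)

end Classes

section Dimensions

variable {A : Type u} [Ring A] (P : ModuleCat.{u} A → Prop) (M : Type u) [AddCommGroup M]
  [Module A M]

/-- There is an exact sequence `0 → M → I_0 → I_1 → ⋯ → I_k → 0` with `I_0, …, I_k` in the class `P`
(prolonged by `I_i = 0` for `i > k`). -/
def HasCoresolution (k : ℕ) : Prop :=
  ∃ (I : ℕ → ModuleCat.{u} A) (ε : M →ₗ[A] I 0) (d : ∀ i, I i →ₗ[A] I (i + 1)),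
    (∀ i ≤ k, P (I i)) ∧ (∀ i, k < i → Subsingleton (I i)) ∧
    Function.Injective ε ∧ Function.Exact ε (d 0) ∧ ∀ i, Function.Exact (d i) (d (i + 1))

/-- There is an exact sequence `0 → F_k → ⋯ → F_1 → F_0 → M → 0` with `F_0, …, F_k` in the class `P`
(prolonged by `F_i = 0` for `i > k`). -/
def HasResolution (k : ℕ) : Prop :=
  ∃ (F : ℕ → ModuleCat.{u} A) (ε : F 0 →ₗ[A] M) (d : ∀ i, F (i + 1) →ₗ[A] F i),
    (∀ i ≤ k, P (F i)) ∧ (∀ i, k < i → Subsingleton (F i)) ∧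
    Function.Surjective ε ∧ Function.Exact (d 0) ε ∧ ∀ i, Function.Exact (d (i + 1)) (d i)

/-- The least `k` for which `M` has a coresolution of length `k` by `P`, and `⊤` if there is none. -/
noncomputable def coresolutionDim : ℕ∞ := ⨅ (k : ℕ) (_ : HasCoresolution P M k), (k : ℕ∞)

/-- The least `k` for which `M` has a resolution of length `k` by `P`, and `⊤` if there is none. -/
noncomputable def resolutionDim : ℕ∞ := ⨅ (k : ℕ) (_ : HasResolution P M k), (k : ℕ∞)

end Dimensions

section FpDimensions

/-- The `fp_n`-injective dimension of the left `A`-module `M`. -/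
noncomputable def fpId (n : ℕ) (A : Type u) [Ring A] (M : Type u) [AddCommGroup M] [Module A M] :
    ℕ∞ :=
  coresolutionDim (fun I : ModuleCat.{u} A => IsFpInjective n A I) M

/-- The `fp_n`-flat dimension of the left `A`-module `M`. -/
noncomputable def fpFd (n : ℕ) (A : Type u) [Ring A] (M : Type u) [AddCommGroup M] [Module A M] :
    ℕ∞ :=
  resolutionDim (fun F : ModuleCat.{u} A => IsFpFlat n A F) M

variable (n : ℕ) (S R : Type u) [Ring S] [Ring R] (C : Type u) [AddCommGroup C] [Module S C]
  [Module Rᵐᵒᵖ C] [SMulCommClass S Rᵐᵒᵖ C]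

/-- The `C`-`fp_n`-injective dimension of the left `R`-module `M`. -/
noncomputable def cFpId (M : Type u) [AddCommGroup M] [Module R M] : ℕ∞ :=
  coresolutionDim (fun I : ModuleCat.{u} R => IsCFpInjective n S R C I) M

/-- The `C`-`fp_n`-flat dimension of the left `S`-module `N`. -/
noncomputable def cFpFd (N : Type u) [AddCommGroup N] [Module S N] : ℕ∞ :=
  resolutionDim (fun F : ModuleCat.{u} S => IsCFpFlat n S R C F) N

end FpDimensions

end FpDim

/-! This is Foxby equivalence. The Auslander class (left `R`-modules) and the Bass class (left
`S`-modules) of `C` consist of the modules at which the unit `M → Hom_S(C, C ⊗_R M)`, resp. the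
counit `C ⊗_R Hom_S(C, N) → N`, is bijective and the relevant Ext and Tor vanish. Between these
classes `C ⊗_R -` and `Hom_S(C, -)` are inverse equivalences, exact on short exact sequences inside
the classes.

Since `fp_n`-injective `S`-modules are Bass and `fp_n`-flat `R`-modules are Auslander, a finite
(co)resolution can be carried termwise through either functor, one short exact sequence at a time.
For the converse it is carried through the other functor, and `IsBass.of_bHom` or
`IsAuslander.of_bTensor` identifies the module so resolved with the original one. Faithfulness of
`C` enters in these two lemmas and in `IsBass.kernel` and `IsAuslander.cokernel`.

For an `fp_n`-injective `X`, all syzygies of `_SC` are finitely `n`-presented, so `Ext_S(C, X) = 0`.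
For the rest, apply `Hom_{Rᵒᵖ}(-, C)` to a resolution of `C_R`: because `Ext(C, C) = 0` and `Hom(C,
C) = S`, this yields short exact sequences of finitely `n`-presented `S`-modules, and `Hom_S(-, X)`
is exact on them. Tensor evaluation `Z ⊗_R Hom_S(C, X) → Hom_S(Hom_{Rᵒᵖ}(Z, C), X)` is bijective for
finitely generated projective `Z`, hence for all syzygies; this gives the vanishing of Tor and, at
`Z = C`, the counit. The flat case is dual, with `Hom_S(Z, C) ⊗_R Y → Hom_S(Z, C ⊗_R Y)`.

Tor is never constructed. Tensor products are tested on characters to `ℚ/ℤ`, through `(C ⊗_R M)⁺ =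
Hom_{Rᵒᵖ}(C, M⁺)`: vanishing of `Tor_i(C, M)` becomes that of `Ext^i(C, M⁺)`, and `Y⁺` is
`fp_n`-injective when `Y` is `fp_n`-flat. -/

namespace FpDim

/-! ### Vanishing of Ext along short exact sequences. -/

section ExtLemmas

open CategoryTheory Abelian

variable {A : Type u} [Ring A]

/-- `Ext^i(K, Z) = 0` for all `i ≥ 1`. -/
def ExtVanish (A : Type u) [Ring A] (K Z : Type u) [AddCommGroup K] [Module A K] [AddCommGroup Z]
    [Module A Z] : Prop :=
  ∀ i : ℕ, Subsingleton (Ext.{u} (ModuleCat.of A K) (ModuleCat.of A Z) (i + 1))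

variable {X₁ X₂ X₃ Z : Type u} [AddCommGroup X₁] [Module A X₁] [AddCommGroup X₂] [Module A X₂]
  [AddCommGroup X₃] [Module A X₃] [AddCommGroup Z] [Module A Z]

lemma shortExact_of {f : X₁ →ₗ[A] X₂} {g : X₂ →ₗ[A] X₃} (hf : Function.Injective f)
    (hfg : Function.Exact f g) (hg : Function.Surjective g) :
    (ShortComplex.mk (ModuleCat.ofHom f) (ModuleCat.ofHom g)
      (by ext x; exact hfg.apply_apply_eq_zero x)).ShortExact where
  exact := (ShortComplex.ShortExact.moduleCat_exact_iff_function_exact _).mpr hfg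
  mono_f := (ModuleCat.mono_iff_injective _).mpr hf
  epi_g := (ModuleCat.epi_iff_surjective _).mpr hg

variable {f : X₁ →ₗ[A] X₂} {g : X₂ →ₗ[A] X₃} (hf : Function.Injective f)
    (hfg : Function.Exact f g) (hg : Function.Surjective g)
include hf hfg hg

lemma exists_extension_of_extVanish (h : ExtVanish A X₃ Z) (u : X₁ →ₗ[A] Z) :
    ∃ v : X₂ →ₗ[A] Z, v ∘ₗ f = u := by
  obtain ⟨x, hx⟩ := Ext.contravariant_sequence_exact₁ (shortExact_of hf hfg hg) (ModuleCat.of A Z)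
    (Ext.mk₀ (ModuleCat.ofHom u)) (n₁ := 1) rfl ((h 0).elim _ _)
  obtain ⟨v, rfl⟩ := (Ext.mk₀_bijective _ _).2 x
  rw [Ext.mk₀_comp_mk₀] at hx
  have := (Ext.mk₀_bijective _ _).1 hx
  refine ⟨v.hom, ?_⟩
  ext x
  exact congrArg (fun w => w.hom x) this

lemma exists_lift_of_extVanish (h : ExtVanish A Z X₁) (u : Z →ₗ[A] X₃) :
    ∃ v : Z →ₗ[A] X₂, g ∘ₗ v = u := by
  obtain ⟨x, hx⟩ := Ext.covariant_sequence_exact₃ (ModuleCat.of A Z) (shortExact_of hf hfg hg)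
    (Ext.mk₀ (ModuleCat.ofHom u)) (n₁ := 1) rfl ((h 0).elim _ _)
  obtain ⟨v, rfl⟩ := (Ext.mk₀_bijective _ _).2 x
  rw [Ext.mk₀_comp_mk₀] at hx
  have := (Ext.mk₀_bijective _ _).1 hx
  refine ⟨v.hom, ?_⟩
  ext x
  exact congrArg (fun w => w.hom x) this

lemma extVanish_quotient (h₁ : ExtVanish A Z X₁) (h₂ : ExtVanish A Z X₂) : ExtVanish A Z X₃ := by
  refine fun i => subsingleton_of_forall_eq 0 fun x => ?_
  obtain ⟨y, rfl⟩ := Ext.covariant_sequence_exact₃ (ModuleCat.of A Z) (shortExact_of hf hfg hg)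
    x (n₁ := i + 1 + 1) rfl ((h₁ (i + 1)).elim _ _)
  rw [(h₂ i).elim y 0, Ext.zero_comp]

/-- In degree 1 the class comes from `Hom(Z, X₃)`, which need not vanish; the lifting hypothesis
makes that connecting map zero. Higher degrees use `h₃`. -/
lemma extVanish_kernel (h₂ : ExtVanish A Z X₂) (h₃ : ExtVanish A Z X₃)
    (hs : ∀ u : Z →ₗ[A] X₃, ∃ v : Z →ₗ[A] X₂, g ∘ₗ v = u) : ExtVanish A Z X₁ := by
  refine fun i => subsingleton_of_forall_eq 0 fun x => ?_
  obtain ⟨y, rfl⟩ := Ext.covariant_sequence_exact₁ (ModuleCat.of A Z) (shortExact_of hf hfg hg)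
    x ((h₂ i).elim _ _) rfl
  obtain _ | i := i
  · obtain ⟨u, rfl⟩ := (Ext.mk₀_bijective _ _).2 y
    obtain ⟨v, hv⟩ := hs u.hom
    have : u = ModuleCat.ofHom v ≫ ModuleCat.ofHom g := by ext x; exact (LinearMap.congr_fun hv x).symm
    rw [this, ← Ext.mk₀_comp_mk₀, Ext.comp_assoc_of_second_deg_zero]
    erw [(shortExact_of hf hfg hg).comp_extClass]
    rw [Ext.comp_zero]
  · rw [(h₃ i).elim y 0, Ext.zero_comp]

lemma extVanish_syzygy [Module.Projective A X₂] (h : ExtVanish A X₃ Z) : ExtVanish A X₁ Z := by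
  refine fun i => subsingleton_of_forall_eq 0 fun x => ?_
  obtain ⟨y, rfl⟩ := Ext.contravariant_sequence_exact₁ (shortExact_of hf hfg hg) (ModuleCat.of A Z)
    x (n₁ := i + 1 + 1) (by omega) ((h (i + 1)).elim _ _)
  have : Projective (ModuleCat.of A X₂) := inferInstance
  have := Ext.subsingleton_of_projective (ModuleCat.of A X₂) (ModuleCat.of A Z) i
  dsimp only at y ⊢
  rw [this.elim y 0, Ext.comp_zero]

lemma subsingleton_ext_one [Module.Projective A X₂]
    (hs : ∀ u : X₁ →ₗ[A] Z, ∃ v : X₂ →ₗ[A] Z, v ∘ₗ f = u) :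
    Subsingleton (Ext.{u} (ModuleCat.of A X₃) (ModuleCat.of A Z) 1) := by
  refine subsingleton_of_forall_eq 0 fun x => ?_
  obtain ⟨y, rfl⟩ := Ext.contravariant_sequence_exact₃ (shortExact_of hf hfg hg) (ModuleCat.of A Z)
    x ((Ext.subsingleton_of_projective (ModuleCat.of A X₂) (ModuleCat.of A Z) 0).elim _ _)
    (n₀ := 0) rfl
  obtain ⟨u, rfl⟩ := (Ext.mk₀_bijective _ _).2 y
  obtain ⟨v, hv⟩ := hs u.hom
  have : u = ModuleCat.ofHom f ≫ ModuleCat.ofHom v := by ext x; exact (LinearMap.congr_fun hv x).symm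
  rw [this, ← Ext.mk₀_comp_mk₀]
  erw [(shortExact_of hf hfg hg).extClass_comp_assoc]

lemma subsingleton_ext_succ [Module.Projective A X₂] (i : ℕ)
    (h : Subsingleton (Ext.{u} (ModuleCat.of A X₁) (ModuleCat.of A Z) i)) :
    Subsingleton (Ext.{u} (ModuleCat.of A X₃) (ModuleCat.of A Z) (i + 1)) := by
  refine subsingleton_of_forall_eq 0 fun x => ?_
  obtain ⟨y, rfl⟩ := Ext.contravariant_sequence_exact₃ (shortExact_of hf hfg hg) (ModuleCat.of A Z)
    x ((Ext.subsingleton_of_projective (ModuleCat.of A X₂) (ModuleCat.of A Z) i).elim _ _)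
    (n₀ := i) (by omega)
  rw [h.elim y 0, Ext.comp_zero]

end ExtLemmas

section ExtMore

open CategoryTheory Abelian

variable {A : Type u} [Ring A]

lemma extVanish_of_subsingleton (K Z : Type u) [AddCommGroup K] [Module A K] [AddCommGroup Z]
    [Module A Z] [Subsingleton Z] : ExtVanish A K Z := by
  refine fun i => subsingleton_of_forall_eq 0 fun x => ?_
  rw [← Ext.comp_mk₀_id x, show 𝟙 (ModuleCat.of A Z) = 0 by ext z; exact Subsingleton.elim (α := Z) _ _,
    Ext.mk₀_zero, Ext.comp_zero]

lemma extVanish_congr {K Z Z' : Type u} [AddCommGroup K] [Module A K] [AddCommGroup Z]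
    [Module A Z] [AddCommGroup Z'] [Module A Z'] (e : Z ≃ₗ[A] Z') (h : ExtVanish A K Z) :
    ExtVanish A K Z' := by
  -- An isomorphism is a short exact sequence with zero kernel.
  refine extVanish_quotient (X₁ := PUnit.{u + 1}) (f := 0) (g := e.toLinearMap)
    (fun _ _ _ => rfl) (fun x => ?_) e.surjective (extVanish_of_subsingleton _ _) h
  simpa using eq_comm

/-- A coinductive criterion for the vanishing of all `Ext^i(K, Z)`, `i ≥ 1`. -/
lemma extVanish_of_coinduction {Z : Type u} [AddCommGroup Z] [Module A Z]
    (Q : ∀ (K : Type u) [AddCommGroup K] [Module A K], Prop)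
    (hQ : ∀ (K : Type u) [AddCommGroup K] [Module A K], Q K →
      ∃ (K' P : ModuleCat.{u} A) (f : K' →ₗ[A] P) (g : P →ₗ[A] K), Module.Projective A P ∧
        Function.Injective f ∧ Function.Exact f g ∧ Function.Surjective g ∧ Q K' ∧
        ∀ u : K' →ₗ[A] Z, ∃ v : P →ₗ[A] Z, v ∘ₗ f = u)
    (K : Type u) [AddCommGroup K] [Module A K] (h : Q K) : ExtVanish A K Z := by
  -- Dimension shifting: `Q` passes to the syzygy, so every degree reduces to degree 1, where the
  -- extension property applies.
  intro i
  induction i generalizing K with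
  | zero =>
    obtain ⟨K', P, f, g, hP, hf, hfg, hg, -, hs⟩ := hQ K h
    exact subsingleton_ext_one hf hfg hg hs
  | succ i ih =>
    obtain ⟨K', P, f, g, hP, hf, hfg, hg, hK', -⟩ := hQ K h
    exact subsingleton_ext_succ hf hfg hg _ (ih K' hK')

end ExtMore

/-! ### Finitely `n`-presented modules: extensions, quotients, summands. -/

section FiniteNPresentation

variable {A : Type u} [Ring A]

lemma FinitelyNPresented.finite {n : ℕ} {M : Type u} [AddCommGroup M] [Module A M]
    (h : FinitelyNPresented A n M) : Module.Finite A M := by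
  obtain ⟨F, d, ε, hF, hε, -, -⟩ := h
  have := (hF 0 (Nat.zero_le _)).2
  exact Module.Finite.of_surjective ε hε

lemma finitelyNPresented_zero {M : Type u} [AddCommGroup M] [Module A M] [Module.Finite A M] :
    FinitelyNPresented A 0 M := by
  obtain ⟨k, f, hf⟩ := Module.Finite.exists_fin' A M
  refine ⟨fun _ => ModuleCat.of A (Fin k → A), fun _ => 0, f, fun _ _ => ⟨?_, ?_⟩, hf, by simp, by simp⟩
  · exact inferInstanceAs (Module.Free A (Fin k → A))
  · exact inferInstanceAs (Module.Finite A (Fin k → A))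

lemma FinitelyNPresented.mono {m n : ℕ} (hmn : m ≤ n) {M : Type u} [AddCommGroup M] [Module A M]
    (h : FinitelyNPresented A n M) : FinitelyNPresented A m M := by
  obtain ⟨F, d, ε, hF, hε, h1, h2⟩ := h
  exact ⟨F, d, ε, fun i hi => hF i (hi.trans hmn), hε, fun h => h1 (h.trans hmn),
    fun i hi => h2 i (hi.trans hmn)⟩

lemma FinitelyNPresented.congr {n : ℕ} {M M' : Type u} [AddCommGroup M] [Module A M]
    [AddCommGroup M'] [Module A M'] (e : M ≃ₗ[A] M') (h : FinitelyNPresented A n M) :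
    FinitelyNPresented A n M' := by
  obtain ⟨F, d, ε, hF, hε, h1, h2⟩ := h
  refine ⟨F, d, e.toLinearMap ∘ₗ ε, hF, e.surjective.comp hε, fun hn x => ?_, h2⟩
  rw [← h1 hn x]
  simp

lemma FinitelyNPresented.exists_presentation {n : ℕ} {M : Type u} [AddCommGroup M] [Module A M]
    (h : FinitelyNPresented A (n + 1) M) :
    ∃ (F : ModuleCat.{u} A) (g : F →ₗ[A] M), Module.Free A F ∧ Module.Finite A F ∧
      Function.Surjective g ∧ FinitelyNPresented A n (LinearMap.ker g) := by
  obtain ⟨F, d, ε, hF, hε, h1, h2⟩ := h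
  have h1 := h1 (by omega)
  refine ⟨F 0, ε, (hF 0 (by omega)).1, (hF 0 (by omega)).2, hε, fun i => F (i + 1),
    fun i => d (i + 1), (d 0).codRestrict _ fun x => h1.apply_apply_eq_zero x,
    fun i hi => hF _ (by omega), ?_, fun hn x => ?_, fun i hi => h2 _ (by omega)⟩
  · rintro ⟨x, hx⟩
    obtain ⟨y, rfl⟩ := (h1 x).1 hx
    exact ⟨y, rfl⟩
  · rw [← h2 0 (by omega) x]
    exact Subtype.ext_iff

lemma FinitelyNPresented.of_presentation {n : ℕ} {K F M : Type u} [AddCommGroup M] [Module A M]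
    [AddCommGroup K] [Module A K] [AddCommGroup F] [Module A F] [Module.Free A F]
    [Module.Finite A F] {f : K →ₗ[A] F} {g : F →ₗ[A] M} (hf : Function.Injective f)
    (hfg : Function.Exact f g) (hg : Function.Surjective g) (h : FinitelyNPresented A n K) :
    FinitelyNPresented A (n + 1) M := by
  obtain ⟨G, d, ε, hG, hε, h1, h2⟩ := h
  refine ⟨fun i => Nat.casesOn i (ModuleCat.of A F) G,
    fun i => Nat.casesOn i (f ∘ₗ ε) d, g, ?_, hg, fun _ x => ?_, ?_⟩
  · rintro (_ | i) hi
    · exact ⟨‹_›, ‹_›⟩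
    · exact hG i (by omega)
  · rw [hfg x]
    constructor
    · rintro ⟨k, rfl⟩
      obtain ⟨y, rfl⟩ := hε k
      exact ⟨y, rfl⟩
    · rintro ⟨y, rfl⟩
      exact ⟨ε y, rfl⟩
  · rintro (_ | i) hi
    · intro x
      change f (ε x) = 0 ↔ _
      rw [map_eq_zero_iff f hf]
      exact h1 (by omega) x
    · exact h2 i (by omega)

lemma finitelyNPresented_of_free (n : ℕ) (F : Type u) [AddCommGroup F] [Module A F]
    [Module.Free A F] [Module.Finite A F] : FinitelyNPresented A n F := by
  refine ⟨fun i => Nat.casesOn i (ModuleCat.of A F) (fun _ => ModuleCat.of A PUnit.{u + 1}),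
    fun i => 0, LinearMap.id, ?_, Function.surjective_id, fun _ x => ?_, fun i _ x => ?_⟩
  · rintro (_ | i) hi
    · exact ⟨‹_›, ‹_›⟩
    · exact ⟨inferInstanceAs (Module.Free A PUnit.{u + 1}), inferInstanceAs (Module.Finite A PUnit.{u + 1})⟩
  · simp [eq_comm]
  · exact ⟨fun _ => ⟨0, Subsingleton.elim (α := PUnit) _ _⟩, fun _ => rfl⟩

lemma finitelyNPresented_of_subsingleton (n : ℕ) (M : Type u) [AddCommGroup M] [Module A M]
    [Subsingleton M] : FinitelyNPresented A n M :=
  (finitelyNPresented_of_free (A := A) n PUnit.{u + 1}).congr (0 : PUnit.{u + 1} ≃ₗ[A] M)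

/-- Horseshoe argument: lifting the cover of `Q` to `L` gives a cover of `L` by `F × G` whose kernel
is an extension of the two kernels, one level down. -/
lemma FinitelyNPresented.extension {n : ℕ} {K L Q : Type u} [AddCommGroup K] [Module A K]
    [AddCommGroup L] [Module A L] [AddCommGroup Q] [Module A Q] {f : K →ₗ[A] L} {g : L →ₗ[A] Q}
    (hf : Function.Injective f) (hfg : Function.Exact f g) (hg : Function.Surjective g)
    (hK : FinitelyNPresented A n K) (hQ : FinitelyNPresented A n Q) :
    FinitelyNPresented A n L := by
  induction n generalizing K L Q with
  | zero =>
    have := hK.finite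
    have := hQ.finite
    have : Module.Finite A (LinearMap.ker g) := by
      rw [LinearMap.exact_iff.1 hfg]
      infer_instance
    have : Module.Finite A (L ⧸ LinearMap.ker g) :=
      Module.Finite.equiv (g.quotKerEquivOfSurjective hg).symm
    have : Module.Finite A L := Module.Finite.of_submodule_quotient (LinearMap.ker g)
    exact finitelyNPresented_zero
  | succ n ih =>
    obtain ⟨F, p, hF1, hF2, hp, hpK⟩ := hK.exists_presentation
    obtain ⟨G, q, hG1, hG2, hq, hqK⟩ := hQ.exists_presentation
    have : Module.Projective A G := Module.Projective.of_free
    obtain ⟨l, hl⟩ := Module.projective_lifting_property g q hg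
    have hl' : ∀ x, g (l x) = q x := fun x => LinearMap.congr_fun hl x
    have hgf : ∀ x, g (f x) = 0 := hfg.apply_apply_eq_zero
    let r : F × G →ₗ[A] L := LinearMap.coprod (f ∘ₗ p) l
    have hr : ∀ x, r x = f (p x.1) + l x.2 := fun x => rfl
    let a : LinearMap.ker p →ₗ[A] LinearMap.ker r :=
      (LinearMap.inl A F G ∘ₗ (LinearMap.ker p).subtype).codRestrict _ fun x => by
        simp [hr]
    let b : LinearMap.ker r →ₗ[A] LinearMap.ker q :=
      (LinearMap.snd A F G ∘ₗ (LinearMap.ker r).subtype).codRestrict _ fun x => by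
        have := congrArg g (hr x.1)
        rw [x.2] at this
        simpa [hgf, hl', eq_comm] using this
    refine FinitelyNPresented.of_presentation (f := (LinearMap.ker r).subtype) (g := r)
      (Submodule.subtype_injective _) (LinearMap.exact_subtype_ker_map r) ?_
      (ih (f := a) (g := b) ?_ ?_ ?_ hpK hqK)
    · intro y
      obtain ⟨z, hz⟩ := hq (g y)
      obtain ⟨k, hk⟩ := (hfg (y - l z)).1 (by rw [map_sub, hl', hz, sub_self])
      obtain ⟨w, rfl⟩ := hp k
      exact ⟨(w, z), by rw [hr, hk]; simp⟩
    · intro x y hxy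
      exact Subtype.ext (congrArg (fun z : LinearMap.ker r => z.1.1) hxy)
    · rintro ⟨⟨x, y⟩, hx⟩
      constructor
      · intro h
        have hy : y = 0 := congrArg Subtype.val h
        subst hy
        refine ⟨⟨x, ?_⟩, rfl⟩
        simpa [hr, map_eq_zero_iff f hf] using hx
      · rintro ⟨z, hz⟩
        exact Subtype.ext (congrArg (fun z : LinearMap.ker r => z.1.2) hz).symm
    · rintro ⟨y, hy⟩
      obtain ⟨k, hk⟩ := (hfg (l y)).1 (by rw [hl']; exact hy)
      obtain ⟨w, rfl⟩ := hp k
      exact ⟨⟨(-w, y), by simp [hr, hk]⟩, rfl⟩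

/-- The kernel of the composite cover `F → L → Q` is an extension of `K` by the kernel of `F → L`,
both finitely `n`-presented. -/
lemma FinitelyNPresented.quotient {n : ℕ} {K L Q : Type u} [AddCommGroup K] [Module A K]
    [AddCommGroup L] [Module A L] [AddCommGroup Q] [Module A Q] {f : K →ₗ[A] L} {g : L →ₗ[A] Q}
    (hf : Function.Injective f) (hfg : Function.Exact f g) (hg : Function.Surjective g)
    (hK : FinitelyNPresented A n K) (hL : FinitelyNPresented A (n + 1) L) :
    FinitelyNPresented A (n + 1) Q := by
  obtain ⟨F, p, hF1, hF2, hp, hpK⟩ := hL.exists_presentation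
  have e : K ≃ₗ[A] LinearMap.ker g :=
    (LinearEquiv.ofInjective f hf).trans (LinearEquiv.ofEq _ _ (LinearMap.exact_iff.1 hfg).symm)
  let a : LinearMap.ker p →ₗ[A] LinearMap.ker (g ∘ₗ p) :=
    (LinearMap.ker p).subtype.codRestrict _ fun x => by simp
  let b : LinearMap.ker (g ∘ₗ p) →ₗ[A] LinearMap.ker g :=
    (p ∘ₗ (LinearMap.ker (g ∘ₗ p)).subtype).codRestrict _ fun x => x.2
  refine FinitelyNPresented.of_presentation (f := (LinearMap.ker (g ∘ₗ p)).subtype) (g := g ∘ₗ p)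
    (Submodule.subtype_injective _) (LinearMap.exact_subtype_ker_map _) (hg.comp hp)
    (FinitelyNPresented.extension (f := a) (g := b) ?_ ?_ ?_ hpK (hK.congr e))
  · intro x y hxy
    exact Subtype.ext (congrArg (fun z : LinearMap.ker (g ∘ₗ p) => z.1) hxy)
  · rintro ⟨x, hx⟩
    constructor
    · intro h
      exact ⟨⟨x, congrArg Subtype.val h⟩, rfl⟩
    · rintro ⟨⟨z, hz⟩, h⟩
      obtain rfl : z = x := congrArg (fun z : LinearMap.ker (g ∘ₗ p) => z.1) h
      exact Subtype.ext hz
  · rintro ⟨y, hy⟩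
    obtain ⟨x, rfl⟩ := hp y
    exact ⟨⟨x, hy⟩, rfl⟩

/-- Induction on the level: the complement `N` is already finitely `n`-presented, and `M` is the
quotient of `M × N` by it. -/
lemma FinitelyNPresented.fst {n : ℕ} {M N : Type u} [AddCommGroup M] [Module A M]
    [AddCommGroup N] [Module A N] (h : FinitelyNPresented A n (M × N)) :
    FinitelyNPresented A n M := by
  induction n generalizing M N with
  | zero =>
    have := h.finite
    have : Module.Finite A M := Module.Finite.of_surjective (LinearMap.fst A M N) LinearMap.fst_surjective
    exact finitelyNPresented_zero
  | succ n ih =>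
    have hN := ih ((h.mono (Nat.le_succ n)).congr (LinearEquiv.prodComm A M N))
    refine FinitelyNPresented.quotient (f := LinearMap.inr A M N) (g := LinearMap.fst A M N)
      LinearMap.inr_injective ?_ LinearMap.fst_surjective hN h
    rintro ⟨x, y⟩
    simp [eq_comm]

lemma FinitelyNPresented.retract {n : ℕ} {M N : Type u} [AddCommGroup M] [Module A M]
    [AddCommGroup N] [Module A N] (s : M →ₗ[A] N) (r : N →ₗ[A] M) (hrs : r ∘ₗ s = LinearMap.id)
    (h : FinitelyNPresented A n N) : FinitelyNPresented A n M := by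
  have hrs' : ∀ x, r (s x) = x := fun x => LinearMap.congr_fun hrs x
  -- The retraction splits `N` as `M × ker r`.
  refine (h.congr (LinearEquiv.ofBijective
    (r.prod ((LinearMap.id - s ∘ₗ r).codRestrict (LinearMap.ker r) fun x => by simp [hrs'])) ⟨?_, ?_⟩)).fst
  · rw [injective_iff_map_eq_zero]
    intro x hx
    have h1 : r x = 0 := congrArg Prod.fst hx
    have h2 : x - s (r x) = 0 := congrArg Subtype.val (congrArg Prod.snd hx)
    simpa [h1] using h2
  · rintro ⟨x, ⟨y, hy⟩⟩
    refine ⟨s x + y, Prod.ext ?_ (Subtype.ext ?_)⟩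
    · simpa [hrs'] using hy
    · have hy' : r y = 0 := hy
      simp [hrs', hy']

lemma FinitelyNPresented.pi {n : ℕ} {M : Type u} [AddCommGroup M] [Module A M]
    (h : FinitelyNPresented A n M) (k : ℕ) : FinitelyNPresented A n (Fin k → M) := by
  induction k with
  | zero => exact finitelyNPresented_of_subsingleton n _
  | succ k ih =>
    refine FinitelyNPresented.congr (Fin.consLinearEquiv A fun _ : Fin (k + 1) => M) ?_
    refine FinitelyNPresented.extension (f := LinearMap.inl A M (Fin k → M))
      (g := LinearMap.snd A M (Fin k → M)) LinearMap.inl_injective ?_ LinearMap.snd_surjective h ih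
    rintro ⟨x, y⟩
    simp [eq_comm]

lemma finitelyNPresented_of_projective (n : ℕ) (P : Type u) [AddCommGroup P] [Module A P]
    [Module.Projective A P] [Module.Finite A P] : FinitelyNPresented A n P := by
  obtain ⟨k, f, hf⟩ := Module.Finite.exists_fin' A P
  obtain ⟨s, hs⟩ := Module.projective_lifting_property f LinearMap.id hf
  exact (finitelyNPresented_of_free n (Fin k → A)).retract s f hs

/-- The syzygy of a module with a degreewise finite projective resolution has one as well. -/
lemma HasDegreewiseFiniteResolution.exists_syzygy {M : Type u} [AddCommGroup M] [Module A M]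
    (h : HasDegreewiseFiniteResolution A M) :
    ∃ (K P : ModuleCat.{u} A) (f : K →ₗ[A] P) (g : P →ₗ[A] M), Module.Projective A P ∧
      Module.Finite A P ∧ Function.Injective f ∧ Function.Exact f g ∧ Function.Surjective g ∧
      HasDegreewiseFiniteResolution A K := by
  obtain ⟨P, d, ε, hP, hε, h1, h2⟩ := h
  refine ⟨ModuleCat.of A (LinearMap.ker ε), P 0, (LinearMap.ker ε).subtype, ε, (hP 0).1, (hP 0).2,
    Submodule.subtype_injective _, LinearMap.exact_subtype_ker_map ε, hε, fun i => P (i + 1),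
    fun i => d (i + 1), (d 0).codRestrict _ fun x => h1.apply_apply_eq_zero x,
    fun i => hP _, ?_, fun x => ?_, fun i => h2 _⟩
  · rintro ⟨x, hx⟩
    obtain ⟨y, rfl⟩ := (h1 x).1 hx
    exact ⟨y, rfl⟩
  · rw [← h2 0 x]
    exact Subtype.ext_iff

lemma HasDegreewiseFiniteResolution.finitelyNPresented {M : Type u} [AddCommGroup M] [Module A M]
    (h : HasDegreewiseFiniteResolution A M) (n : ℕ) : FinitelyNPresented A n M := by
  induction n generalizing M with
  | zero =>
    obtain ⟨K, P, f, g, -, hP, -, -, hg, -⟩ := h.exists_syzygy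
    have := Module.Finite.of_surjective g hg
    exact finitelyNPresented_zero
  | succ n ih =>
    obtain ⟨K, P, f, g, hP, hP', hf, hfg, hg, hK⟩ := h.exists_syzygy
    exact FinitelyNPresented.quotient hf hfg hg (ih hK) (finitelyNPresented_of_projective _ P)

end FiniteNPresentation

/-! ### Characters with values in `ℚ/ℤ`. -/

section Characters

/-- The injective cogenerator `ℚ/ℤ` of abelian groups. -/
abbrev QZ : Type := AddCircle (1 : ℚ)

/-- Injectivity of `ℚ/ℤ`: `φ` descends to `M / ker g`, which embeds in `N`. -/
lemma exists_char_factor {M N : Type*} [AddCommGroup M] [AddCommGroup N] (g : M →+ N)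
    (φ : M →+ QZ) (h : ∀ x, g x = 0 → φ x = 0) : ∃ ψ : N →+ QZ, ∀ x, ψ (g x) = φ x := by
  have hinj : Function.Injective (QuotientAddGroup.kerLift g) := QuotientAddGroup.kerLift_injective g
  obtain ⟨ψ, hψ⟩ := CharacterModule.dual_surjective_of_injective
    (R := ℤ) (QuotientAddGroup.kerLift g).toIntLinearMap hinj
    (QuotientAddGroup.lift g.ker φ fun x hx => h x hx : M ⧸ g.ker →+ QZ)
  exact ⟨ψ, fun x => DFunLike.congr_fun hψ (QuotientAddGroup.mk x : M ⧸ g.ker)⟩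

lemma eq_zero_of_char {M : Type*} [AddCommGroup M] {x : M} (h : ∀ φ : M →+ QZ, φ x = 0) : x = 0 :=
  CharacterModule.eq_zero_of_character_apply fun c => h c

/-- Characters separate the points of the cokernel of `f`. This is how surjectivity is proved below.
-/
lemma exists_preimage_of_char {M N : Type*} [AddCommGroup M] [AddCommGroup N] (f : M →+ N) (x : N)
    (h : ∀ φ : N →+ QZ, (∀ m, φ (f m) = 0) → φ x = 0) : ∃ m, f m = x := by
  have : (QuotientAddGroup.mk x : N ⧸ f.range) = 0 := eq_zero_of_char fun φ =>
    h (φ.comp (QuotientAddGroup.mk' f.range)) fun m => by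
      have : (QuotientAddGroup.mk' f.range) (f m) = 0 :=
        (QuotientAddGroup.eq_zero_iff _).2 ⟨m, rfl⟩
      rw [AddMonoidHom.comp_apply, this, map_zero]
  exact (QuotientAddGroup.eq_zero_iff _).1 this

/-- The character group `M⁺ = Hom_ℤ(M, ℚ/ℤ)` of a left `A`-module, as a right `A`-module. -/
def CharDual (A : Type*) (M : Type u) [Ring A] [AddCommGroup M] [Module A M] : Type u := M →+ QZ

variable {A : Type*} [Ring A] {M M' M'' : Type u} [AddCommGroup M] [Module A M] [AddCommGroup M']
  [Module A M'] [AddCommGroup M''] [Module A M'']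

noncomputable instance : AddCommGroup (CharDual A M) := inferInstanceAs (AddCommGroup (M →+ QZ))

instance : FunLike (CharDual A M) M QZ := inferInstanceAs (FunLike (M →+ QZ) M QZ)

instance : AddMonoidHomClass (CharDual A M) M QZ :=
  inferInstanceAs (AddMonoidHomClass (M →+ QZ) M QZ)

@[ext] lemma CharDual.ext {φ ψ : CharDual A M} (h : ∀ x, φ x = ψ x) : φ = ψ := DFunLike.ext _ _ h

@[simp] lemma CharDual.zero_apply (x : M) : (0 : CharDual A M) x = 0 := rfl

noncomputable instance : Module Aᵐᵒᵖ (CharDual A M) where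
  smul a φ := (φ : M →+ QZ).comp (DistribSMul.toAddMonoidHom M a.unop)
  one_smul φ := CharDual.ext fun x => congrArg φ (one_smul A x)
  mul_smul a b φ := CharDual.ext fun x => congrArg φ (mul_smul b.unop a.unop x)
  smul_zero _ := rfl
  smul_add _ _ _ := rfl
  add_smul a b φ := CharDual.ext fun x =>
    (congrArg φ (add_smul a.unop b.unop x)).trans (map_add φ _ _)
  zero_smul φ := CharDual.ext fun x => (congrArg φ (zero_smul A x)).trans (map_zero φ)

lemma CharDual.sum_apply {ι : Type*} (s : Finset ι) (w : ι → CharDual A M) (x : M) :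
    (∑ j ∈ s, w j) x = ∑ j ∈ s, w j x :=
  map_sum (AddMonoidHom.mk' (fun φ : CharDual A M => φ x) fun _ _ => rfl) w s

/-- The map `M'⁺ → M⁺` induced by `f : M → M'`. -/
noncomputable def charMap (f : M →ₗ[A] M') : CharDual A M' →ₗ[Aᵐᵒᵖ] CharDual A M where
  toFun φ := AddMonoidHom.comp (show M' →+ QZ from φ) f.toAddMonoidHom
  map_add' _ _ := rfl
  map_smul' a φ := CharDual.ext fun x => congrArg φ (map_smul f a.unop x).symm

@[simp] lemma charMap_apply (f : M →ₗ[A] M') (φ : CharDual A M') (x : M) :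
    charMap f φ x = φ (f x) := rfl

lemma charMap_injective {f : M →ₗ[A] M'} (hf : Function.Surjective f) :
    Function.Injective (charMap f) := by
  refine fun φ ψ h => CharDual.ext fun x => ?_
  obtain ⟨y, rfl⟩ := hf x
  exact DFunLike.congr_fun h y

lemma charMap_surjective {f : M →ₗ[A] M'} (hf : Function.Injective f) :
    Function.Surjective (charMap f) := by
  intro φ
  obtain ⟨ψ, hψ⟩ := exists_char_factor f.toAddMonoidHom φ fun x hx => by
    rw [hf ((show f x = 0 from hx).trans (map_zero f).symm)]; exact map_zero φ
  exact ⟨ψ, CharDual.ext hψ⟩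

lemma charMap_exact {f : M →ₗ[A] M'} {g : M' →ₗ[A] M''} (hfg : Function.Exact f g) :
    Function.Exact (charMap g) (charMap f) := by
  intro φ
  constructor
  · intro h
    obtain ⟨ψ, hψ⟩ := exists_char_factor g.toAddMonoidHom φ fun x hx => by
      obtain ⟨y, rfl⟩ := (hfg x).1 hx
      exact DFunLike.congr_fun h y
    exact ⟨ψ, CharDual.ext hψ⟩
  · rintro ⟨ψ, rfl⟩
    ext x
    simp [hfg.apply_apply_eq_zero]

lemma subsingleton_of_charDual [Subsingleton (CharDual A M)] : Subsingleton M :=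
  subsingleton_of_forall_eq 0 fun x => eq_zero_of_char fun φ => by
    have : (show CharDual A M from φ) = 0 := Subsingleton.elim _ _
    exact DFunLike.congr_fun this x

/-- Isomorphic modules have isomorphic character modules. -/
noncomputable def charCongr (e : M ≃ₗ[A] M') : CharDual A M ≃ₗ[Aᵐᵒᵖ] CharDual A M' :=
  LinearEquiv.ofBijective (charMap e.symm.toLinearMap)
    ⟨charMap_injective e.symm.surjective, charMap_surjective e.symm.injective⟩

end Characters

/-! ### The balanced tensor product and its adjunction with characters. -/

section BalancedTensor

variable {R : Type u} [Ring R] {A : Type*} [Ring A] {C M M' M'' : Type u} [AddCommGroup C]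
  [Module A C] [Module Rᵐᵒᵖ C] [SMulCommClass A Rᵐᵒᵖ C] [AddCommGroup M] [Module R M]
  [AddCommGroup M'] [Module R M'] [AddCommGroup M''] [Module R M'']

variable (R A) in
/-- The elementary tensor `c ⊗ m` in `C ⊗_R M`. -/
def btmul (c : C) (m : M) : BTensor R A C M := Submodule.Quotient.mk (c ⊗ₜ[ℤ] m)

lemma btmul_add (c : C) (m m' : M) :
    btmul R A c (m + m') = btmul R A c m + btmul R A c m' := by
  simp only [btmul, TensorProduct.tmul_add, Submodule.Quotient.mk_add]

lemma add_btmul (c c' : C) (m : M) :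
    btmul R A (c + c') m = btmul R A c m + btmul R A c' m := by
  simp only [btmul, TensorProduct.add_tmul, Submodule.Quotient.mk_add]

lemma op_smul_btmul (r : R) (c : C) (m : M) :
    btmul R A (MulOpposite.op r • c) m = btmul R A c (r • m) :=
  (Submodule.Quotient.eq _).2 (AddSubgroup.subset_closure ⟨c, r, m, rfl⟩)

lemma BTensor.induction {p : BTensor R A C M → Prop} (h : ∀ c m, p (btmul R A c m)) (h0 : p 0)
    (hadd : ∀ x y, p x → p y → p (x + y)) (x : BTensor R A C M) : p x := by
  obtain ⟨x, rfl⟩ := Submodule.Quotient.mk_surjective _ x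
  induction x with
  | zero => exact h0
  | tmul c m => exact h c m
  | add x y hx hy => exact hadd _ _ hx hy

lemma BTensor.addHom_ext {Q : Type*} [AddCommMonoid Q] {f g : BTensor R A C M →+ Q}
    (h : ∀ c m, f (btmul R A c m) = g (btmul R A c m)) : f = g := by
  ext x
  induction x using BTensor.induction with
  | h c m => exact h c m
  | h0 => simp
  | hadd x y hx hy => rw [map_add, map_add, hx, hy]

/-- The additive map out of `C ⊗_R M` given by a balanced biadditive map. -/
def btLift {Q : Type*} [AddCommGroup Q] (w : C →+ M →+ Q)
    (hw : ∀ (r : R) (c : C) (m : M), w (MulOpposite.op r • c) m = w c (r • m)) :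
    BTensor R A C M →+ Q :=
  QuotientAddGroup.lift (balancedSubmodule R A C M).toAddSubgroup
    (TensorProduct.liftAddHom w fun z c m => by
      rw [map_zsmul, map_zsmul, AddMonoidHom.zsmul_apply]) (by
    refine (AddSubgroup.closure_le _).2 ?_
    rintro _ ⟨c, r, m, rfl⟩
    refine (map_sub _ _ _).trans ?_
    rw [TensorProduct.liftAddHom_tmul, TensorProduct.liftAddHom_tmul, hw, sub_self])

/-- The `A`-linear map out of `C ⊗_R M` given by a balanced biadditive map, `A`-linear in `C`. -/
def btLiftLinear {Q : Type*} [AddCommGroup Q] [Module A Q] (w : C →+ M →+ Q)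
    (hw : ∀ (r : R) (c : C) (m : M), w (MulOpposite.op r • c) m = w c (r • m))
    (hA : ∀ (a : A) (c : C) (m : M), w (a • c) m = a • w c m) :
    BTensor R A C M →ₗ[A] Q where
  toFun := btLift w hw
  map_add' := map_add _
  map_smul' a x := by
    rw [RingHom.id_apply]
    induction x using BTensor.induction with
    | h c m => exact hA a c m
    | h0 => rw [smul_zero, map_zero, smul_zero]
    | hadd x y hx hy => rw [smul_add, map_add, map_add, hx, hy, smul_add]

variable (A) in
/-- The character of `C ⊗_R M` corresponding to a map `C → M⁺` of right `R`-modules. -/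
noncomputable def charOfHom (v : C →ₗ[Rᵐᵒᵖ] CharDual R M) : BTensor R A C M →+ QZ :=
  btLift (show C →+ M →+ QZ from v.toAddMonoidHom) fun r c m =>
    DFunLike.congr_fun (map_smul v (MulOpposite.op r) c) m

/-- The map `C → M⁺` of right `R`-modules corresponding to a character of `C ⊗_R M`. -/
noncomputable def homOfChar (φ : BTensor R A C M →+ QZ) : C →ₗ[Rᵐᵒᵖ] CharDual R M where
  toFun c := (AddMonoidHom.mk' (fun m => φ (btmul R A c m)) fun m m' => by
    rw [btmul_add, map_add] : M →+ QZ)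
  map_add' c c' := CharDual.ext fun m => by
    change φ (btmul R A (c + c') m) = φ (btmul R A c m) + φ (btmul R A c' m)
    rw [add_btmul, map_add]
  map_smul' r c := CharDual.ext fun m => congrArg φ (op_smul_btmul r.unop c m)

@[simp] lemma homOfChar_apply (φ : BTensor R A C M →+ QZ) (c : C) (m : M) :
    homOfChar φ c m = φ (btmul R A c m) := rfl

variable (R A C) in
/-- The map `C ⊗_R M → C ⊗_R M'` induced by `f : M → M'`. -/
def btMap (f : M →ₗ[R] M') : BTensor R A C M →ₗ[A] BTensor R A C M' :=
  btLiftLinear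
    (AddMonoidHom.mk' (fun c => AddMonoidHom.mk' (fun m => btmul R A c (f m))
      fun m m' => by rw [map_add, btmul_add])
      fun c c' => AddMonoidHom.ext fun m => add_btmul c c' (f m))
    (fun r c m => by
      change btmul R A (MulOpposite.op r • c) (f m) = btmul R A c (f (r • m))
      rw [op_smul_btmul, map_smul])
    (fun a c m => rfl)

lemma BTensor.hom_ext {Q : Type*} [AddCommGroup Q] [Module A Q] {f g : BTensor R A C M →ₗ[A] Q}
    (h : ∀ c m, f (btmul R A c m) = g (btmul R A c m)) : f = g := by
  have := BTensor.addHom_ext (f := f.toAddMonoidHom) (g := g.toAddMonoidHom) h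
  exact LinearMap.ext fun x => DFunLike.congr_fun this x

lemma btMap_comp (f : M →ₗ[R] M') (g : M' →ₗ[R] M'') :
    btMap R A C (g ∘ₗ f) = btMap R A C g ∘ₗ btMap R A C f :=
  BTensor.hom_ext fun _ _ => rfl

lemma btMap_id : btMap R A C (LinearMap.id : M →ₗ[R] M) = LinearMap.id :=
  BTensor.hom_ext fun _ _ => rfl

lemma btMap_zero : btMap R A C (0 : M →ₗ[R] M') = 0 :=
  BTensor.hom_ext fun c m => by
    have := btmul_add (R := R) (A := A) c (0 : M') 0
    rw [add_zero, left_eq_add] at this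
    exact this

lemma btMap_surjective {g : M →ₗ[R] M'} (hg : Function.Surjective g) :
    Function.Surjective (btMap R A C g) := by
  intro x
  induction x using BTensor.induction with
  | h c m => obtain ⟨y, rfl⟩ := hg m; exact ⟨btmul R A c y, rfl⟩
  | h0 => exact ⟨0, map_zero _⟩
  | hadd x y hx hy =>
    obtain ⟨x, rfl⟩ := hx
    obtain ⟨y, rfl⟩ := hy
    exact ⟨x + y, map_add _ _ _⟩

/-- A character of `C ⊗ M'` that kills the image of `C ⊗ M` is a map `C → M'⁺` landing in `M''⁺`, so
it factors through `C ⊗ M''`. -/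
lemma btMap_exact {f : M →ₗ[R] M'} {g : M' →ₗ[R] M''} (hfg : Function.Exact f g)
    (hg : Function.Surjective g) : Function.Exact (btMap R A C f) (btMap R A C g) := by
  intro x
  constructor
  · intro hx
    refine exists_preimage_of_char (btMap R A C f).toAddMonoidHom x fun φ hφ => ?_
    have h0 : ∀ c m, homOfChar φ c (f m) = 0 := fun c m => hφ (btmul R A c m)
    have h1 : ∀ c, ∃ ψ, charMap g ψ = homOfChar φ c := fun c =>
      (charMap_exact hfg _).1 (CharDual.ext fun m => h0 c m)
    choose v hv using h1
    let w : C →ₗ[Rᵐᵒᵖ] CharDual R M'' :=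
      { toFun := v
        map_add' := fun c c' => charMap_injective hg (by simp only [map_add, hv])
        map_smul' := fun r c => charMap_injective hg (by simp only [map_smul, hv, RingHom.id_apply]) }
    have : φ = (charOfHom A w).comp (btMap R A C g).toAddMonoidHom := BTensor.addHom_ext fun c m =>
      (DFunLike.congr_fun (hv c) m).symm
    rw [this]
    change charOfHom A w (btMap R A C g x) = 0
    rw [hx, map_zero]
  · rintro ⟨y, rfl⟩
    have : g ∘ₗ f = 0 := LinearMap.ext fun z => hfg.apply_apply_eq_zero z
    rw [← LinearMap.comp_apply, ← btMap_comp, this, btMap_zero, LinearMap.zero_apply]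

/-- A map is injective exactly when its character dual is surjective; by adjunction that dual is
`Hom(C, M'⁺) → Hom(C, M⁺)`. -/
lemma btMap_injective_iff {f : M →ₗ[R] M'} :
    Function.Injective (btMap R A C f) ↔
      ∀ v : C →ₗ[Rᵐᵒᵖ] CharDual R M, ∃ w : C →ₗ[Rᵐᵒᵖ] CharDual R M', charMap f ∘ₗ w = v := by
  constructor
  · intro h v
    obtain ⟨ψ, hψ⟩ := exists_char_factor (btMap R A C f).toAddMonoidHom (charOfHom A v) fun x hx => by
      rw [h ((show btMap R A C f x = 0 from hx).trans (map_zero _).symm), map_zero]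
    exact ⟨homOfChar ψ, LinearMap.ext fun c => CharDual.ext fun m => hψ (btmul R A c m)⟩
  · intro h
    rw [injective_iff_map_eq_zero]
    refine fun x hx => eq_zero_of_char fun φ => ?_
    obtain ⟨w, hw⟩ := h (homOfChar φ)
    have : φ = (charOfHom A w).comp (btMap R A C f).toAddMonoidHom := BTensor.addHom_ext fun c m =>
      (DFunLike.congr_fun (LinearMap.congr_fun hw c) m).symm
    rw [this]
    change charOfHom A w (btMap R A C f x) = 0
    rw [hx, map_zero]

end BalancedTensor

/-! ### The functor `Hom_S(C, -)`, unit, counit and triangle identities. -/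

section Hom

variable {S R : Type u} [Ring S] [Ring R] {C N N' N'' : Type u} [AddCommGroup C] [Module S C]
  [Module Rᵐᵒᵖ C] [SMulCommClass S Rᵐᵒᵖ C] [AddCommGroup N] [Module S N]
  [AddCommGroup N'] [Module S N'] [AddCommGroup N''] [Module S N'']

instance : FunLike (BHom S C N) C N := inferInstanceAs (FunLike (C →ₗ[S] N) C N)

instance : LinearMapClass (BHom S C N) S C N := inferInstanceAs (LinearMapClass (C →ₗ[S] N) S C N)

@[ext] lemma BHom.ext {f g : BHom S C N} (h : ∀ c, f c = g c) : f = g := DFunLike.ext _ _ h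

variable (R C) in
/-- The map `Hom_S(C, N) → Hom_S(C, N')` induced by `g : N → N'`. -/
def bhMap (g : N →ₗ[S] N') : BHom S C N →ₗ[R] BHom S C N' where
  toFun f := LinearMap.comp g (show C →ₗ[S] N from f)
  map_add' _ _ := BHom.ext fun _ => map_add g _ _
  map_smul' _ _ := rfl

lemma bhMap_injective {g : N →ₗ[S] N'} (hg : Function.Injective g) :
    Function.Injective (bhMap R C g) :=
  fun _ _ h => BHom.ext fun c => hg (DFunLike.congr_fun h c)

lemma exists_lift_of_exact {K : Type u} [AddCommGroup K] [Module S K] {f : N →ₗ[S] N'}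
    {g : N' →ₗ[S] N''} (hf : Function.Injective f) (hfg : Function.Exact f g) (v : K →ₗ[S] N')
    (hv : g ∘ₗ v = 0) : ∃ w : K →ₗ[S] N, f ∘ₗ w = v := by
  have : ∀ c, ∃ y, f y = v c := fun c => (hfg _).1 (LinearMap.congr_fun hv c)
  choose w hw using this
  exact ⟨{ toFun := w
           map_add' := fun c c' => hf (by simp only [map_add, hw])
           map_smul' := fun r c => hf (by simp only [map_smul, hw, RingHom.id_apply]) },
    LinearMap.ext hw⟩

lemma bhMap_exact {f : N →ₗ[S] N'} {g : N' →ₗ[S] N''} (hf : Function.Injective f)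
    (hfg : Function.Exact f g) : Function.Exact (bhMap R C f) (bhMap R C g) := by
  intro x
  constructor
  · intro h
    exact exists_lift_of_exact hf hfg (show C →ₗ[S] N' from x) h
  · rintro ⟨y, rfl⟩
    ext c
    exact hfg.apply_apply_eq_zero _

variable {M M' : Type u} [AddCommGroup M] [Module R M] [AddCommGroup M'] [Module R M']

variable (S R C M) in
/-- The unit `M → Hom_S(C, C ⊗_R M)`. -/
def bunit : M →ₗ[R] BHom S C (BTensor R S C M) where
  toFun m := { toFun := fun c => btmul R S c m
               map_add' := fun c c' => add_btmul c c' m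
               map_smul' := fun _ _ => rfl }
  map_add' m m' := BHom.ext fun c => btmul_add c m m'
  map_smul' r m := BHom.ext fun c => (op_smul_btmul r c m).symm

variable (S R C N) in
/-- The counit `C ⊗_R Hom_S(C, N) → N`. -/
def bcounit : BTensor R S C (BHom S C N) →ₗ[S] N :=
  btLiftLinear
    (AddMonoidHom.mk' (fun c => AddMonoidHom.mk' (fun f : BHom S C N => f c) fun _ _ => rfl)
      fun c c' => AddMonoidHom.ext fun f => map_add f c c')
    (fun _ _ _ => rfl) (fun a c f => map_smul f a c)

lemma bunit_naturality (f : M →ₗ[R] M') (m : M) :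
    bhMap R C (btMap R S C f) (bunit S R C M m) = bunit S R C M' (f m) := rfl

lemma bcounit_naturality (g : N →ₗ[S] N') (x : BTensor R S C (BHom S C N)) :
    bcounit S R C N' (btMap R S C (bhMap R C g) x) = g (bcounit S R C N x) := by
  have : bcounit S R C N' ∘ₗ btMap R S C (bhMap R C g) = g ∘ₗ bcounit S R C N :=
    BTensor.hom_ext fun _ _ => rfl
  exact LinearMap.congr_fun this x

lemma bcounit_btMap_bunit (x : BTensor R S C M) :
    bcounit S R C (BTensor R S C M) (btMap R S C (bunit S R C M) x) = x := by
  have : bcounit S R C (BTensor R S C M) ∘ₗ btMap R S C (bunit S R C M) = LinearMap.id :=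
    BTensor.hom_ext fun _ _ => rfl
  exact LinearMap.congr_fun this x

lemma bhMap_bcounit_bunit (f : BHom S C N) :
    bhMap R C (bcounit S R C N) (bunit S R C (BHom S C N) f) = f := rfl

end Hom

/-! ### The functor `Hom(-, C)` and finitely generated projectives. -/

section Precomposition

variable {A : Type u} [Ring A] {Z Z' Z'' : Type u} [AddCommGroup Z] [Module A Z] [AddCommGroup Z']
  [Module A Z'] [AddCommGroup Z''] [Module A Z'']

/-- Precomposition with `f`, as an additive map. -/
def preAdd (f : Z →ₗ[A] Z') (T : Type u) [AddCommGroup T] [Module A T] :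
    (Z' →ₗ[A] T) →+ (Z →ₗ[A] T) where
  toFun g := g ∘ₗ f
  map_zero' := rfl
  map_add' _ _ := rfl

@[simp] lemma preAdd_apply (f : Z →ₗ[A] Z') {T : Type u} [AddCommGroup T] [Module A T]
    (g : Z' →ₗ[A] T) : preAdd f T g = g ∘ₗ f := rfl

lemma exists_factor_of_exact {T : Type u} [AddCommGroup T] [Module A T] {f : Z →ₗ[A] Z'}
    {g : Z' →ₗ[A] Z''} (hfg : Function.Exact f g) (hg : Function.Surjective g) (h : Z' →ₗ[A] T)
    (hh : h ∘ₗ f = 0) : ∃ k : Z'' →ₗ[A] T, k ∘ₗ g = h := by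
  have hker : LinearMap.ker g ≤ LinearMap.ker h := fun x hx => by
    obtain ⟨y, rfl⟩ := (hfg x).1 hx
    exact LinearMap.congr_fun hh y
  refine ⟨(LinearMap.ker g).liftQ h hker ∘ₗ (g.quotKerEquivOfSurjective hg).symm.toLinearMap,
    LinearMap.ext fun x => ?_⟩
  have : (g.quotKerEquivOfSurjective hg).symm (g x) = Submodule.Quotient.mk x := by
    rw [LinearEquiv.symm_apply_eq]; rfl
  change (LinearMap.ker g).liftQ h hker ((g.quotKerEquivOfSurjective hg).symm (g x)) = h x
  rw [this]
  rfl

variable (B : Type u) [Ring B] (C : Type u) [AddCommGroup C] [Module A C] [Module B C]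
  [SMulCommClass A B C]

/-- Precomposition with `f`, as a `B`-linear map `Hom_A(Z', C) → Hom_A(Z, C)`. -/
def preComp (f : Z →ₗ[A] Z') : (Z' →ₗ[A] C) →ₗ[B] (Z →ₗ[A] C) where
  toFun g := g ∘ₗ f
  map_add' _ _ := rfl
  map_smul' _ _ := rfl

@[simp] lemma preComp_apply (f : Z →ₗ[A] Z') (g : Z' →ₗ[A] C) : preComp B C f g = g ∘ₗ f := rfl

lemma preComp_injective {g : Z' →ₗ[A] Z''} (hg : Function.Surjective g) :
    Function.Injective (preComp B C g) := fun _ _ h => (LinearMap.cancel_right hg).1 h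

lemma preComp_exact {f : Z →ₗ[A] Z'} {g : Z' →ₗ[A] Z''} (hfg : Function.Exact f g)
    (hg : Function.Surjective g) : Function.Exact (preComp B C g) (preComp B C f) := by
  intro h
  refine ⟨exists_factor_of_exact hfg hg h, ?_⟩
  rintro ⟨k, rfl⟩
  ext x
  simp [hfg.apply_apply_eq_zero]

/-- The `B`-linear map `C → Hom_A(Z, C)`, `c ↦ (z ↦ φ(z) c)`, given by `φ : Z → A`. -/
def smulRightLin (φ : Z →ₗ[A] A) : C →ₗ[B] (Z →ₗ[A] C) where
  toFun c := φ.smulRight c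
  map_add' c c' := by ext; simp
  map_smul' b c := by ext z; exact smul_comm (φ z) b c

@[simp] lemma smulRightLin_apply (φ : Z →ₗ[A] A) (c : C) (z : Z) :
    smulRightLin B C φ c z = φ z • c := rfl

lemma exists_dual_basis (A : Type u) [Ring A] (P : Type u) [AddCommGroup P] [Module A P]
    [Module.Projective A P] [Module.Finite A P] :
    ∃ (k : ℕ) (p : Fin k → P) (φ : Fin k → P →ₗ[A] A), ∀ x, ∑ j, φ j x • p j = x := by
  obtain ⟨k, f, hf⟩ := Module.Finite.exists_fin' A P
  obtain ⟨s, hs⟩ := Module.projective_lifting_property f LinearMap.id hf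
  refine ⟨k, fun j => f (Pi.single j 1), fun j => LinearMap.proj j ∘ₗ s, fun x => ?_⟩
  have h : s x = ∑ j, s x j • (Pi.single j 1 : Fin k → A) := by
    conv_lhs => rw [pi_eq_sum_univ' (s x)]
  conv_rhs => rw [← LinearMap.id_apply (R := A) x, ← hs, LinearMap.comp_apply, h, map_sum]
  simp

/-- `Hom(P, C)` is a summand of `Hom(A^k, C) = C^k`. -/
lemma finitelyNPresented_hom_of_projective {n : ℕ} (hC : FinitelyNPresented B n C) (P : Type u)
    [AddCommGroup P] [Module A P] [Module.Projective A P] [Module.Finite A P] :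
    FinitelyNPresented B n (P →ₗ[A] C) := by
  obtain ⟨k, f, hf⟩ := Module.Finite.exists_fin' A P
  obtain ⟨s, hs⟩ := Module.projective_lifting_property f LinearMap.id hf
  refine ((hC.pi k).congr ((Pi.basisFun A (Fin k)).constr B)).retract (preComp B C f)
    (preComp B C s) ?_
  ext g x
  exact congrArg g (LinearMap.congr_fun hs x)

end Precomposition

/-! ### Syzygies on which `Hom(-, C)` is exact. -/

section CSyzygy

/-- The properties of the syzygies of `C` that are needed to compute with `Hom_A(-, C)`. -/
structure IsCSyzygy (A B C : Type u) [Ring A] [Ring B] [AddCommGroup C] [Module A C] [Module B C]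
    [SMulCommClass A B C] (K : Type u) [AddCommGroup K] [Module A K] : Prop where
  resolution : HasDegreewiseFiniteResolution A K
  ext : ExtVanish A K C
  hom : ∀ n, FinitelyNPresented B n (K →ₗ[A] C)

variable {A B C : Type u} [Ring A] [Ring B] [AddCommGroup C] [Module A C] [Module B C]
    [SMulCommClass A B C]

/-- Vanishing of `Ext¹(K, C)` makes `0 → Hom(K, C) → Hom(P, C) → Hom(K', C) → 0` exact, so finite
presentation of the first two terms passes to the third and the construction can be iterated. -/
lemma IsCSyzygy.exists_syzygy (hC : ∀ n, FinitelyNPresented B n C) {K : Type u} [AddCommGroup K]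
    [Module A K] (h : IsCSyzygy A B C K) :
    ∃ (K' P : ModuleCat.{u} A) (f : K' →ₗ[A] P) (g : P →ₗ[A] K), Module.Projective A P ∧
      Module.Finite A P ∧ Function.Injective f ∧ Function.Exact f g ∧ Function.Surjective g ∧
      Function.Surjective (preComp B C f) ∧ (∀ n, FinitelyNPresented B n (P →ₗ[A] C)) ∧
      IsCSyzygy A B C K' := by
  obtain ⟨K', P, f, g, hP, hP', hf, hfg, hg, hK'⟩ := h.resolution.exists_syzygy
  have hs : Function.Surjective (preComp B C f) := fun u =>
    exists_extension_of_extVanish hf hfg hg h.ext u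
  have hPC : ∀ n, FinitelyNPresented B n (P →ₗ[A] C) := fun n =>
    finitelyNPresented_hom_of_projective B C (hC n) P
  exact ⟨K', P, f, g, hP, hP', hf, hfg, hg, hs, hPC, hK', extVanish_syzygy hf hfg hg h.ext,
    fun n => (FinitelyNPresented.quotient (preComp_injective B C hg) (preComp_exact B C hfg hg) hs
      (h.hom n) (hPC (n + 1))).mono (Nat.le_succ n)⟩

end CSyzygy

/-! ### First consequences of `fp_n`-injectivity and `fp_n`-flatness. -/

section Injective

variable {A : Type u} [Ring A] {n : ℕ} {X : Type u} [AddCommGroup X] [Module A X]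

lemma IsFpInjective.extVanish (hX : IsFpInjective n A X) {K : Type u} [AddCommGroup K]
    [Module A K] (hK : HasDegreewiseFiniteResolution A K) : ExtVanish A K X := by
  refine extVanish_of_coinduction (fun K _ _ => HasDegreewiseFiniteResolution A K) ?_ K hK
  intro K _ _ hK
  obtain ⟨K', P, f, g, hP, hP', hf, hfg, hg, hK'⟩ := hK.exists_syzygy
  -- The inclusion of the syzygy is an injection of finitely `n`-presented modules, against which
  -- `X` is injective by definition.
  exact ⟨K', P, f, g, hP, hf, hfg, hg, hK', fun u => hX _ _ f (hK'.finitelyNPresented n)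
    (finitelyNPresented_of_projective n P) hf u⟩

lemma IsFpInjective.congr {X' : Type u} [AddCommGroup X'] [Module A X'] (e : X ≃ₗ[A] X')
    (hX : IsFpInjective n A X) : IsFpInjective n A X' := by
  intro K L _ _ _ _ i hK hL hi u
  obtain ⟨v, hv⟩ := hX K L i hK hL hi (e.symm.toLinearMap ∘ₗ u)
  refine ⟨e.toLinearMap ∘ₗ v, LinearMap.ext fun x => ?_⟩
  have := LinearMap.congr_fun hv x
  change e (v (i x)) = u x
  rw [← LinearEquiv.eq_symm_apply]
  exact this

lemma IsFpFlat.charDual {Y : Type u} [AddCommGroup Y] [Module A Y] (hY : IsFpFlat n A Y) :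
    IsFpInjective n Aᵐᵒᵖ (CharDual A Y) := by
  intro K L _ _ _ _ i hK hL hi u
  have hinj := hY K L i hK hL hi
  obtain ⟨ψ, hψ⟩ := exists_char_factor (bTensorMap A Y i).toAddMonoidHom (charOfHom ℤ u)
    fun x hx => by
      rw [hinj ((show bTensorMap A Y i x = 0 from hx).trans (map_zero _).symm), map_zero]
  exact ⟨homOfChar ψ, LinearMap.ext fun c => CharDual.ext fun m => hψ (btmul A ℤ c m)⟩

end Injective

/-! ### Tensor evaluation: `fp_n`-injective modules and the Bass class. -/

section InjectiveBass

variable {S R : Type u} [Ring S] [Ring R] {C : Type u} [AddCommGroup C] [Module S C]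
  [Module Rᵐᵒᵖ C] [SMulCommClass S Rᵐᵒᵖ C] [SMulCommClass Rᵐᵒᵖ S C]
  {X : Type u} [AddCommGroup X] [Module S X]
  {Z : Type u} [AddCommGroup Z] [Module Rᵐᵒᵖ Z]

variable (S R C X Z) in
/-- The functional `g ↦ f (g z)` on `Hom_{Rᵒᵖ}(Z, C)` given by `z` and `f : C → X`. -/
def evalAt (z : Z) (f : BHom S C X) : (Z →ₗ[Rᵐᵒᵖ] C) →ₗ[S] X where
  toFun g := f (g z)
  map_add' _ _ := map_add f _ _
  map_smul' s g := map_smul f s (g z)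

/-- The dual of the tensor evaluation `Z ⊗_R Hom_S(C, X) → Hom_S(Hom_{Rᵒᵖ}(Z, C), X)`. -/
noncomputable def tensorEvalDual (Φ : ((Z →ₗ[Rᵐᵒᵖ] C) →ₗ[S] X) →+ QZ) :
    Z →ₗ[Rᵐᵒᵖ] CharDual R (BHom S C X) where
  toFun z := (AddMonoidHom.mk' (fun f => Φ (evalAt S R C X Z z f)) fun f f' => by
    rw [← map_add]; rfl : BHom S C X →+ QZ)
  map_add' z z' := CharDual.ext fun f => by
    change Φ _ = Φ _ + Φ _
    rw [← map_add]
    exact congrArg Φ (LinearMap.ext fun g => (congrArg f (map_add g z z')).trans (map_add f _ _))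
  map_smul' r z := CharDual.ext fun f =>
    congrArg Φ (LinearMap.ext fun g => congrArg f (map_smul g r z))

@[simp] lemma tensorEvalDual_apply (Φ : ((Z →ₗ[Rᵐᵒᵖ] C) →ₗ[S] X) →+ QZ) (z : Z)
    (f : BHom S C X) : tensorEvalDual Φ z f = Φ (evalAt S R C X Z z f) := rfl

lemma tensorEvalDual_comp {Z' : Type u} [AddCommGroup Z'] [Module Rᵐᵒᵖ Z'] (f : Z →ₗ[Rᵐᵒᵖ] Z')
    (Φ : ((Z' →ₗ[Rᵐᵒᵖ] C) →ₗ[S] X) →+ QZ) :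
    tensorEvalDual (Φ.comp (preAdd (preComp S C f) X)) = tensorEvalDual Φ ∘ₗ f := rfl

/-- Surjectivity of tensor evaluation in dual form: a dual basis of `Z` writes each `u` as a sum of
maps `evalAt`. -/
lemma eq_zero_of_tensorEvalDual_projective [Module.Projective Rᵐᵒᵖ Z] [Module.Finite Rᵐᵒᵖ Z]
    (Φ : ((Z →ₗ[Rᵐᵒᵖ] C) →ₗ[S] X) →+ QZ) (h : tensorEvalDual Φ = 0) : Φ = 0 := by
  obtain ⟨k, p, φ, hp⟩ := exists_dual_basis Rᵐᵒᵖ Z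
  ext u
  have hu : u = ∑ j, evalAt S R C X Z (p j) (u ∘ₗ smulRightLin S C (φ j)) := by
    ext g
    have hg : g = ∑ j, smulRightLin S C (φ j) (g (p j)) := by
      ext x
      conv_lhs => rw [← hp x, map_sum]
      simp
    conv_lhs => rw [hg, map_sum]
    rw [LinearMap.sum_apply]
    rfl
  rw [hu, map_sum]
  exact Finset.sum_eq_zero fun j _ => DFunLike.congr_fun (LinearMap.congr_fun h (p j)) _

lemma exists_tensorEvalDual_projective [Module.Projective Rᵐᵒᵖ Z] [Module.Finite Rᵐᵒᵖ Z]
    (v : Z →ₗ[Rᵐᵒᵖ] CharDual R (BHom S C X)) :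
    ∃ Φ : ((Z →ₗ[Rᵐᵒᵖ] C) →ₗ[S] X) →+ QZ, tensorEvalDual Φ = v := by
  obtain ⟨k, p, φ, hp⟩ := exists_dual_basis Rᵐᵒᵖ Z
  refine ⟨∑ j, AddMonoidHom.comp (show BHom S C X →+ QZ from v (p j))
    (preAdd (smulRightLin S C (φ j)) X), LinearMap.ext fun z => CharDual.ext fun f => ?_⟩
  rw [tensorEvalDual_apply, AddMonoidHom.finsetSum_apply]
  conv_rhs => rw [← hp z, map_sum]
  rw [CharDual.sum_apply]
  refine Finset.sum_congr rfl fun j _ => ?_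
  rw [map_smul]
  rfl

variable (hC : ∀ n, FinitelyNPresented S n C) {n : ℕ} (hX : IsFpInjective n S X)
include hC hX

/-- Every `u : Hom(Z, C) → X` extends to `Hom(P, C)` because `X` is `fp_n`-injective, which reduces
the claim to the projective `P`. -/
lemma eq_zero_of_tensorEvalDual (hZ : IsCSyzygy Rᵐᵒᵖ S C Z)
    (Φ : ((Z →ₗ[Rᵐᵒᵖ] C) →ₗ[S] X) →+ QZ) (h : tensorEvalDual Φ = 0) : Φ = 0 := by
  obtain ⟨Z', P, f, g, hP, hP', hf, hfg, hg, hs, hPC, hZ'⟩ := hZ.exists_syzygy hC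
  have h0 : Φ.comp (preAdd (preComp S C g) X) = 0 :=
    eq_zero_of_tensorEvalDual_projective _ (by rw [tensorEvalDual_comp, h, LinearMap.zero_comp])
  ext u
  obtain ⟨v, rfl⟩ := hX _ _ (preComp S C g) (hZ.hom n) (hPC n) (preComp_injective S C hg) u
  exact DFunLike.congr_fun h0 v

/-- Injectivity of tensor evaluation in dual form. The functional representing `v ∘ g` on `P`
vanishes on what comes from `Z'`, by the dual surjectivity there, so it descends to `Z`. -/
lemma exists_tensorEvalDual (hZ : IsCSyzygy Rᵐᵒᵖ S C Z)
    (v : Z →ₗ[Rᵐᵒᵖ] CharDual R (BHom S C X)) :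
    ∃ Φ : ((Z →ₗ[Rᵐᵒᵖ] C) →ₗ[S] X) →+ QZ, tensorEvalDual Φ = v := by
  obtain ⟨Z', P, f, g, hP, hP', hf, hfg, hg, hs, hPC, hZ'⟩ := hZ.exists_syzygy hC
  obtain ⟨Ψ, hΨ⟩ := exists_tensorEvalDual_projective (v ∘ₗ g)
  have h0 : Ψ.comp (preAdd (preComp S C f) X) = 0 :=
    eq_zero_of_tensorEvalDual hC hX hZ' _ (by
      ext z w
      rw [tensorEvalDual_comp, hΨ]
      simp [hfg.apply_apply_eq_zero])
  obtain ⟨Φ, hΦ⟩ := exists_char_factor (preAdd (preComp S C g) X) Ψ fun u hu => by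
    obtain ⟨k, rfl⟩ := exists_factor_of_exact (preComp_exact S C hfg hg) hs u hu
    exact DFunLike.congr_fun h0 k
  refine ⟨Φ, (LinearMap.cancel_right hg).1 ?_⟩
  rw [← tensorEvalDual_comp, ← hΨ]
  exact congrArg tensorEvalDual (AddMonoidHom.ext hΦ)

lemma extVanish_charDual_bHom (hZ : IsCSyzygy Rᵐᵒᵖ S C Z) :
    ExtVanish Rᵐᵒᵖ Z (CharDual R (BHom S C X)) := by
  refine extVanish_of_coinduction (fun Z _ _ => IsCSyzygy Rᵐᵒᵖ S C Z) ?_ Z hZ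
  intro Z _ _ hZ
  obtain ⟨Z', P, f, g, hP, hP', hf, hfg, hg, hs, hPC, hZ'⟩ := hZ.exists_syzygy hC
  refine ⟨Z', P, f, g, hP, hf, hfg, hg, hZ', fun v => ?_⟩
  obtain ⟨Φ, rfl⟩ := exists_tensorEvalDual hC hX hZ' v
  -- `Hom(P, C) → Hom(Z', C)` is onto, so `Hom_S(-, X)` turns it into an injection, along which the
  -- character `Φ` extends.
  obtain ⟨Ψ, hΨ⟩ := exists_char_factor (preAdd (preComp S C f) X) Φ fun u hu => by
    rw [(LinearMap.cancel_right hs).1 ((show u ∘ₗ preComp S C f = 0 from hu).trans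
      (LinearMap.zero_comp _).symm), map_zero]
  refine ⟨tensorEvalDual Ψ, ?_⟩
  rw [← tensorEvalDual_comp]
  exact congrArg tensorEvalDual (AddMonoidHom.ext hΨ)

/-- At `Z = C` the homothety gives `Hom_S(Hom(C, C), X) = Hom_S(S, X) = X`, and tensor evaluation
becomes the counit. -/
lemma bcounit_bijective_of_fpInjective (hZ : IsCSyzygy Rᵐᵒᵖ S C C)
    (hS : Function.Bijective (leftMul S R C)) : Function.Bijective (bcounit S R C X) := by
  let σ : S ≃ₗ[S] (C →ₗ[Rᵐᵒᵖ] C) := LinearEquiv.ofBijective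
    ({ toFun := leftMul S R C
       map_add' := fun s t => LinearMap.ext fun c => add_smul s t c
       map_smul' := fun s t => LinearMap.ext fun c => mul_smul s t c } : S →ₗ[S] C →ₗ[Rᵐᵒᵖ] C) hS
  let e : X →+ ((C →ₗ[Rᵐᵒᵖ] C) →ₗ[S] X) := AddMonoidHom.mk'
    (fun x => LinearMap.toSpanSingleton S X x ∘ₗ σ.symm.toLinearMap) fun x y => by
      ext g
      simp
  have heval : ∀ (c : C) (f : BHom S C X), e (f c) = evalAt S R C X C c f := by
    intro c f
    ext g
    obtain ⟨s, rfl⟩ := σ.surjective g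
    change (σ.symm (σ s)) • f c = f (s • c)
    rw [σ.symm_apply_apply, map_smul]
  constructor
  · rw [injective_iff_map_eq_zero]
    refine fun x hx => eq_zero_of_char fun φ => ?_
    obtain ⟨Φ, hΦ⟩ := exists_tensorEvalDual hC hX hZ (homOfChar φ)
    have : φ = Φ.comp (e.comp (bcounit S R C X).toAddMonoidHom) := by
      refine BTensor.addHom_ext fun c f => ?_
      change _ = Φ (e (f c))
      rw [heval, ← tensorEvalDual_apply, hΦ, homOfChar_apply]
    rw [this]
    change Φ (e (bcounit S R C X x)) = 0
    rw [hx, map_zero, map_zero]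
  · intro x
    refine exists_preimage_of_char (bcounit S R C X).toAddMonoidHom x fun φ hφ => ?_
    -- Evaluation at the identity undoes `e`, so `Φ` is `φ` transported along `e`.
    let Φ : ((C →ₗ[Rᵐᵒᵖ] C) →ₗ[S] X) →+ QZ :=
      φ.comp (AddMonoidHom.mk' (fun h => h LinearMap.id) fun _ _ => rfl)
    have h0 : Φ = 0 := eq_zero_of_tensorEvalDual hC hX hZ Φ
      (LinearMap.ext fun c => CharDual.ext fun f => hφ (btmul R S c f))
    have h1 : σ.symm LinearMap.id = 1 := by
      rw [LinearEquiv.symm_apply_eq]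
      exact LinearMap.ext fun c => (one_smul S c).symm
    have h2 : Φ (e x) = φ x := by
      change φ (σ.symm LinearMap.id • x) = φ x
      rw [h1, one_smul]
    rw [← h2, h0, AddMonoidHom.zero_apply]

end InjectiveBass

/-! ### Homomorphism evaluation: `fp_n`-flat modules and the Auslander class. -/

section FlatAuslander

variable {S R : Type u} [Ring S] [Ring R] {C : Type u} [AddCommGroup C] [Module S C]
  [Module Rᵐᵒᵖ C] [SMulCommClass S Rᵐᵒᵖ C] {Y : Type u} [AddCommGroup Y] [Module R Y]
  {Z : Type u} [AddCommGroup Z] [Module S Z]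

/-- The map `z ↦ g z ⊗ y`. -/
def tmulRight (g : Z →ₗ[S] C) (y : Y) : Z →ₗ[S] BTensor R S C Y :=
  (show C →ₗ[S] BTensor R S C Y from bunit S R C Y y) ∘ₗ g

/-- The dual of the tensor evaluation `Hom_S(Z, C) ⊗_R Y → Hom_S(Z, C ⊗_R Y)`. -/
noncomputable def homEvalDual (φ : (Z →ₗ[S] BTensor R S C Y) →+ QZ) :
    (Z →ₗ[S] C) →ₗ[Rᵐᵒᵖ] CharDual R Y where
  toFun g := (AddMonoidHom.mk' (fun y => φ (tmulRight g y)) fun y y' => by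
    rw [← map_add]
    exact congrArg φ (LinearMap.ext fun z => btmul_add _ _ _) : Y →+ QZ)
  map_add' g g' := CharDual.ext fun y => by
    change φ _ = φ _ + φ _
    rw [← map_add]
    exact congrArg φ (LinearMap.ext fun z => add_btmul _ _ _)
  map_smul' r g := CharDual.ext fun y =>
    congrArg φ (LinearMap.ext fun z => op_smul_btmul r.unop (g z) y)

@[simp] lemma homEvalDual_apply (φ : (Z →ₗ[S] BTensor R S C Y) →+ QZ) (g : Z →ₗ[S] C) (y : Y) :
    homEvalDual φ g y = φ (tmulRight g y) := rfl

lemma homEvalDual_comp {Z' : Type u} [AddCommGroup Z'] [Module S Z'] (f : Z →ₗ[S] Z')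
    (φ : (Z →ₗ[S] BTensor R S C Y) →+ QZ) :
    homEvalDual (φ.comp (preAdd f (BTensor R S C Y))) = homEvalDual φ ∘ₗ preComp Rᵐᵒᵖ C f := rfl

lemma homEvalDual_sub (φ φ' : (Z →ₗ[S] BTensor R S C Y) →+ QZ) :
    homEvalDual (φ - φ') = homEvalDual φ - homEvalDual φ' := rfl

lemma eq_zero_of_homEvalDual_projective [Module.Projective S Z] [Module.Finite S Z]
    (φ : (Z →ₗ[S] BTensor R S C Y) →+ QZ) (h : homEvalDual φ = 0) : φ = 0 := by
  obtain ⟨k, p, π, hp⟩ := exists_dual_basis S Z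
  have h1 : ∀ (j : Fin k) (t : BTensor R S C Y), φ ((π j).smulRight t) = 0 := by
    intro j t
    induction t using BTensor.induction with
    | h c y =>
      exact DFunLike.congr_fun (LinearMap.congr_fun h (smulRightLin Rᵐᵒᵖ C (π j) c)) y
    | h0 => rw [LinearMap.smulRight_zero, map_zero]
    | hadd x y hx hy =>
      have : (π j).smulRight (x + y) = (π j).smulRight x + (π j).smulRight y := by
        ext z; simp
      rw [this, map_add, hx, hy, add_zero]
  ext u
  have hu : u = ∑ j, (π j).smulRight (u (p j)) := by
    ext z
    conv_lhs => rw [← hp z, map_sum]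
    simp
  rw [hu, map_sum]
  exact Finset.sum_eq_zero fun j _ => h1 j _

lemma exists_homEvalDual_projective [Module.Projective S Z] [Module.Finite S Z]
    (v : (Z →ₗ[S] C) →ₗ[Rᵐᵒᵖ] CharDual R Y) :
    ∃ φ : (Z →ₗ[S] BTensor R S C Y) →+ QZ, homEvalDual φ = v := by
  obtain ⟨k, p, π, hp⟩ := exists_dual_basis S Z
  refine ⟨∑ j, (charOfHom S (v ∘ₗ smulRightLin Rᵐᵒᵖ C (π j))).comp
    (AddMonoidHom.mk' (fun u => u (p j)) fun _ _ => rfl),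
    LinearMap.ext fun g => CharDual.ext fun y => ?_⟩
  rw [homEvalDual_apply, AddMonoidHom.finsetSum_apply]
  have hg : g = ∑ j, smulRightLin Rᵐᵒᵖ C (π j) (g (p j)) := by
    ext x
    conv_lhs => rw [← hp x, map_sum]
    simp
  conv_rhs => rw [hg, map_sum, CharDual.sum_apply]
  rfl

variable (hC : ∀ n, FinitelyNPresented Rᵐᵒᵖ n C) {n : ℕ}
  (hY : IsFpInjective n Rᵐᵒᵖ (CharDual R Y))
include hC hY

/-- Here existence comes first: `fp_n`-injectivity of `Y⁺` extends `v` from `Hom(Z, C)` to `Hom(P,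
C)`, where the projective case applies. -/
lemma exists_homEvalDual (hZ : IsCSyzygy S Rᵐᵒᵖ C Z)
    (v : (Z →ₗ[S] C) →ₗ[Rᵐᵒᵖ] CharDual R Y) :
    ∃ φ : (Z →ₗ[S] BTensor R S C Y) →+ QZ, homEvalDual φ = v := by
  obtain ⟨Z', P, f, g, hP, hP', hf, hfg, hg, hs, hPC, hZ'⟩ := hZ.exists_syzygy hC
  obtain ⟨w, rfl⟩ := hY _ _ (preComp Rᵐᵒᵖ C g) (hZ.hom n) (hPC n) (preComp_injective Rᵐᵒᵖ C hg) v
  obtain ⟨φ, rfl⟩ := exists_homEvalDual_projective w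
  exact ⟨φ.comp (preAdd g _), homEvalDual_comp g φ⟩

lemma eq_zero_of_homEvalDual (hZ : IsCSyzygy S Rᵐᵒᵖ C Z)
    (φ : (Z →ₗ[S] BTensor R S C Y) →+ QZ) (h : homEvalDual φ = 0) : φ = 0 := by
  obtain ⟨Z', P, f, g, hP, hP', hf, hfg, hg, hs, hPC, hZ'⟩ := hZ.exists_syzygy hC
  obtain ⟨ψ, hψ⟩ := exists_char_factor (preAdd g (BTensor R S C Y)) φ fun u hu => by
    rw [(LinearMap.cancel_right hg).1 ((show u ∘ₗ g = 0 from hu).trans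
      (LinearMap.zero_comp _).symm), map_zero]
  have hψ' : ψ.comp (preAdd g _) = φ := AddMonoidHom.ext hψ
  obtain ⟨w, hw⟩ := exists_factor_of_exact (preComp_exact Rᵐᵒᵖ C hfg hg) hs (homEvalDual ψ) (by
    rw [← homEvalDual_comp, hψ', h])
  obtain ⟨χ, rfl⟩ := exists_homEvalDual hC hY hZ' w
  -- On `P` the dual determines the functional, so `ψ` is induced from `Z'`; it therefore kills `u ∘
  -- g`, as `g ∘ f = 0`.
  have h0 : ψ - χ.comp (preAdd f _) = 0 := eq_zero_of_homEvalDual_projective _ (by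
    rw [homEvalDual_sub, homEvalDual_comp, hw, sub_self])
  ext u
  rw [← hψ, sub_eq_zero.1 h0]
  have : (u ∘ₗ g) ∘ₗ f = 0 := by ext x; simp [hfg.apply_apply_eq_zero]
  simp [this]

lemma extVanish_bTensor (hZ : IsCSyzygy S Rᵐᵒᵖ C Z) : ExtVanish S Z (BTensor R S C Y) := by
  refine extVanish_of_coinduction (fun Z _ _ => IsCSyzygy S Rᵐᵒᵖ C Z) ?_ Z hZ
  intro Z _ _ hZ
  obtain ⟨Z', P, f, g, hP, hP', hf, hfg, hg, hs, hPC, hZ'⟩ := hZ.exists_syzygy hC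
  refine ⟨Z', P, f, g, hP, hf, hfg, hg, hZ', fun v => ?_⟩
  -- A character killing all restrictions from `P` has zero dual, since each map `Z' → C` is such a
  -- restriction; hence it is zero.
  refine exists_preimage_of_char (preAdd f (BTensor R S C Y)) v fun φ hφ => ?_
  rw [eq_zero_of_homEvalDual hC hY hZ' φ, AddMonoidHom.zero_apply]
  ext k y
  obtain ⟨l, rfl⟩ := hs k
  exact hφ (tmulRight l y)

lemma bunit_bijective_of_fpInjective (hZ : IsCSyzygy S Rᵐᵒᵖ C C)
    (hR : Function.Bijective (rightMul S R C)) : Function.Bijective (bunit S R C Y) := by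
  let σ : Rᵐᵒᵖ ≃ₗ[Rᵐᵒᵖ] (C →ₗ[S] C) := LinearEquiv.ofBijective
    ({ toFun := fun r => rightMul S R C r.unop
       map_add' := fun s t => LinearMap.ext fun c => add_smul s t c
       map_smul' := fun s t => LinearMap.ext fun c => mul_smul s t c } : Rᵐᵒᵖ →ₗ[Rᵐᵒᵖ] C →ₗ[S] C)
    (hR.comp MulOpposite.unop_bijective)
  have h1 : σ.symm LinearMap.id = 1 := by
    rw [LinearEquiv.symm_apply_eq]
    exact LinearMap.ext fun c => (one_smul Rᵐᵒᵖ c).symm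
  constructor
  · rw [injective_iff_map_eq_zero]
    refine fun y hy => eq_zero_of_char fun φ' => ?_
    let φ : CharDual R Y := φ'
    -- The map `Hom_S(C, C) ≅ Rᵒᵖ → Y⁺` sending the identity to `φ`; its functional `χ` recovers `φ
    -- y` from the unit at `y`.
    obtain ⟨χ, hχ⟩ := exists_homEvalDual hC hY hZ
      (LinearMap.toSpanSingleton Rᵐᵒᵖ (CharDual R Y) φ ∘ₗ σ.symm.toLinearMap)
    have h2 := DFunLike.congr_fun (LinearMap.congr_fun hχ LinearMap.id) y
    have h3 : homEvalDual χ LinearMap.id y = 0 := by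
      rw [homEvalDual_apply]
      exact (congrArg χ hy).trans (map_zero χ)
    rw [h3] at h2
    simp only [LinearMap.comp_apply, LinearEquiv.coe_coe, h1,
      LinearMap.toSpanSingleton_apply, one_smul] at h2
    exact h2.symm
  · intro u
    refine exists_preimage_of_char (bunit S R C Y).toAddMonoidHom u fun φ hφ => ?_
    have h0 : (show (C →ₗ[S] BTensor R S C Y) →+ QZ from φ) = 0 := by
      refine eq_zero_of_homEvalDual hC hY hZ _ (LinearMap.ext fun g => CharDual.ext fun y => ?_)
      obtain ⟨r, rfl⟩ := σ.surjective g
      refine Eq.trans ?_ (hφ (r.unop • y))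
      exact congrArg φ (BHom.ext fun c => op_smul_btmul r.unop c y)
    exact DFunLike.congr_fun h0 u

end FlatAuslander

/-! ### Two cases of the five lemma. -/

section FiveLemma

variable {A : Type*} [Ring A] {X₁ X₂ X₃ Y₁ Y₂ Y₃ : Type*} [AddCommGroup X₁] [Module A X₁]
  [AddCommGroup X₂] [Module A X₂] [AddCommGroup X₃] [Module A X₃] [AddCommGroup Y₁] [Module A Y₁]
  [AddCommGroup Y₂] [Module A Y₂] [AddCommGroup Y₃] [Module A Y₃] {f : X₁ →ₗ[A] X₂}
  {g : X₂ →ₗ[A] X₃} {f' : Y₁ →ₗ[A] Y₂} {g' : Y₂ →ₗ[A] Y₃} {a : X₁ →ₗ[A] Y₁} {b : X₂ →ₗ[A] Y₂}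
  {c : X₃ →ₗ[A] Y₃} (h₁ : ∀ x, b (f x) = f' (a x)) (h₂ : ∀ x, c (g x) = g' (b x))
include h₁ h₂

lemma bijective_kernel (hf : Function.Injective f) (hfg : Function.Exact f g)
    (hf' : Function.Injective f') (hfg' : Function.Exact f' g') (hb : Function.Bijective b)
    (hc : Function.Injective c) : Function.Bijective a := by
  refine ⟨fun x y hxy => hf (hb.1 (by rw [h₁, h₁, hxy])), fun y => ?_⟩
  obtain ⟨x, hx⟩ := hb.2 (f' y)
  obtain ⟨z, rfl⟩ := (hfg x).1 (hc (by rw [h₂, hx, hfg'.apply_apply_eq_zero, map_zero]))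
  exact ⟨z, hf' (by rw [← h₁, hx])⟩

lemma bijective_cokernel (hfg : Function.Exact f g) (hg : Function.Surjective g)
    (hfg' : Function.Exact f' g') (hg' : Function.Surjective g') (ha : Function.Surjective a)
    (hb : Function.Bijective b) : Function.Bijective c := by
  constructor
  · rw [injective_iff_map_eq_zero]
    intro x hx
    obtain ⟨y, rfl⟩ := hg x
    rw [h₂] at hx
    obtain ⟨z, hz⟩ := (hfg' _).1 hx
    obtain ⟨w, rfl⟩ := ha z
    rw [← h₁] at hz
    rw [← hb.1 hz, hfg.apply_apply_eq_zero]
  · intro y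
    obtain ⟨z, rfl⟩ := hg' y
    obtain ⟨x, rfl⟩ := hb.2 z
    exact ⟨g x, h₂ x⟩

end FiveLemma

/-! ### The Auslander and Bass classes. -/

section Classes

variable (S R : Type u) [Ring S] [Ring R] (C : Type u) [AddCommGroup C] [Module S C]
  [Module Rᵐᵒᵖ C] [SMulCommClass S Rᵐᵒᵖ C]

/-- `M` is in the Auslander class of `C`; the vanishing of `Tor_i^R(C, M)` is expressed as that of
`Ext^i_{Rᵒᵖ}(C, M⁺)`. -/
structure IsAuslander (M : Type u) [AddCommGroup M] [Module R M] : Prop where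
  tor : ExtVanish Rᵐᵒᵖ C (CharDual R M)
  ext : ExtVanish S C (BTensor R S C M)
  unit : Function.Bijective (bunit S R C M)

/-- `N` is in the Bass class of `C`; the vanishing of `Tor_i^R(C, Hom_S(C, N))` is expressed as that
of `Ext^i_{Rᵒᵖ}(C, Hom_S(C, N)⁺)`. -/
structure IsBass (N : Type u) [AddCommGroup N] [Module S N] : Prop where
  ext : ExtVanish S C N
  tor : ExtVanish Rᵐᵒᵖ C (CharDual R (BHom S C N))
  counit : Function.Bijective (bcounit S R C N)

variable {S R C}

lemma isCSyzygy_right (hC : IsSemidualizing S R C) [SMulCommClass Rᵐᵒᵖ S C] :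
    IsCSyzygy Rᵐᵒᵖ S C C := by
  refine ⟨hC.right_resolution, fun i => hC.right_ext (i + 1) (by omega), fun n => ?_⟩
  refine (finitelyNPresented_of_free n S).congr (LinearEquiv.ofBijective
    ({ toFun := leftMul S R C
       map_add' := fun s t => LinearMap.ext fun c => add_smul s t c
       map_smul' := fun s t => LinearMap.ext fun c => mul_smul s t c } : S →ₗ[S] C →ₗ[Rᵐᵒᵖ] C)
    hC.left_homothety)

lemma isCSyzygy_left (hC : IsSemidualizing S R C) : IsCSyzygy S Rᵐᵒᵖ C C := by
  refine ⟨hC.left_resolution, fun i => hC.left_ext (i + 1) (by omega), fun n => ?_⟩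
  refine (finitelyNPresented_of_free n Rᵐᵒᵖ).congr (LinearEquiv.ofBijective
    ({ toFun := fun r => rightMul S R C r.unop
       map_add' := fun s t => LinearMap.ext fun c => add_smul s t c
       map_smul' := fun s t => LinearMap.ext fun c => mul_smul s t c } : Rᵐᵒᵖ →ₗ[Rᵐᵒᵖ] C →ₗ[S] C)
    (hC.right_homothety.comp MulOpposite.unop_bijective))

lemma IsFpInjective.isBass (hC : IsSemidualizing S R C) {n : ℕ} {X : Type u} [AddCommGroup X]
    [Module S X] (hX : IsFpInjective n S X) : IsBass S R C X := by
  have := SMulCommClass.symm S Rᵐᵒᵖ C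
  have hS : ∀ n, FinitelyNPresented S n C := hC.left_resolution.finitelyNPresented
  exact ⟨hX.extVanish hC.left_resolution, extVanish_charDual_bHom hS hX (isCSyzygy_right hC),
    bcounit_bijective_of_fpInjective hS hX (isCSyzygy_right hC) hC.left_homothety⟩

lemma IsFpFlat.isAuslander (hC : IsSemidualizing S R C) {n : ℕ} {Y : Type u} [AddCommGroup Y]
    [Module R Y] (hY : IsFpFlat n R Y) : IsAuslander S R C Y := by
  have hR : ∀ n, FinitelyNPresented Rᵐᵒᵖ n C := hC.right_resolution.finitelyNPresented
  exact ⟨hY.charDual.extVanish hC.right_resolution,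
    extVanish_bTensor hR hY.charDual (isCSyzygy_left hC),
    bunit_bijective_of_fpInjective hR hY.charDual (isCSyzygy_left hC) hC.right_homothety⟩

/-- `Hom_S(C, -)` of an isomorphism. -/
def bhCongr {N N' : Type u} [AddCommGroup N] [Module S N] [AddCommGroup N'] [Module S N']
    (e : N ≃ₗ[S] N') : BHom S C N ≃ₗ[R] BHom S C N' :=
  LinearEquiv.ofLinearMap (bhMap R C e.toLinearMap) (bhMap R C e.symm.toLinearMap)
    (LinearMap.ext fun f => BHom.ext fun c => e.apply_symm_apply (f c))
    (LinearMap.ext fun f => BHom.ext fun c => e.symm_apply_apply (f c))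

/-- `C ⊗_R -` of an isomorphism. -/
def btCongr {M M' : Type u} [AddCommGroup M] [Module R M] [AddCommGroup M'] [Module R M']
    (e : M ≃ₗ[R] M') : BTensor R S C M ≃ₗ[S] BTensor R S C M' :=
  LinearEquiv.ofLinearMap (btMap R S C e.toLinearMap) (btMap R S C e.symm.toLinearMap)
    (by rw [← btMap_comp, LinearEquiv.comp_symm, btMap_id])
    (by rw [← btMap_comp, LinearEquiv.symm_comp, btMap_id])

/-- The unit is an isomorphism on the Auslander class. -/
noncomputable def IsAuslander.equiv {M : Type u} [AddCommGroup M] [Module R M]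
    (h : IsAuslander S R C M) : M ≃ₗ[R] BHom S C (BTensor R S C M) :=
  LinearEquiv.ofBijective _ h.unit

/-- The counit is an isomorphism on the Bass class. -/
noncomputable def IsBass.equiv {N : Type u} [AddCommGroup N] [Module S N]
    (h : IsBass S R C N) : BTensor R S C (BHom S C N) ≃ₗ[S] N :=
  LinearEquiv.ofBijective _ h.counit

/-- By a triangle identity the unit at `Hom_S(C, N)` is inverse to `Hom_S(C, counit)`, an
isomorphism here. -/
lemma IsBass.bHom {N : Type u} [AddCommGroup N] [Module S N] (h : IsBass S R C N) :
    IsAuslander S R C (BHom S C N) := by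
  refine ⟨h.tor, extVanish_congr h.equiv.symm h.ext, ?_⟩
  have hb : Function.Bijective (bhMap R C (bcounit S R C N)) := (bhCongr h.equiv).bijective
  refine ⟨fun f f' hff => ?_, fun x => ⟨bhMap R C (bcounit S R C N) x, hb.1 rfl⟩⟩
  rw [← bhMap_bcounit_bunit (R := R) f, hff, bhMap_bcounit_bunit]

lemma IsAuslander.bTensor {M : Type u} [AddCommGroup M] [Module R M] (h : IsAuslander S R C M) :
    IsBass S R C (BTensor R S C M) := by
  refine ⟨h.ext, extVanish_congr (charCongr h.equiv) h.tor, ?_⟩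
  have hb : Function.Bijective (btMap R S C (bunit S R C M)) := (btCongr h.equiv).bijective
  refine ⟨fun x y hxy => ?_, fun x => ⟨btMap R S C (bunit S R C M) x, bcounit_btMap_bunit x⟩⟩
  obtain ⟨x, rfl⟩ := hb.2 x
  obtain ⟨y, rfl⟩ := hb.2 y
  rw [bcounit_btMap_bunit, bcounit_btMap_bunit] at hxy
  rw [hxy]

/-! ### Short exact sequences in the two classes, and the role of faithfulness. -/

section ShortExact

variable {M₁ M₂ M₃ : Type u} [AddCommGroup M₁] [Module R M₁] [AddCommGroup M₂] [Module R M₂]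
  [AddCommGroup M₃] [Module R M₃] {f : M₁ →ₗ[R] M₂} {g : M₂ →ₗ[R] M₃}
  {N₁ N₂ N₃ : Type u} [AddCommGroup N₁] [Module S N₁] [AddCommGroup N₂] [Module S N₂]
  [AddCommGroup N₃] [Module S N₃] {p : N₁ →ₗ[S] N₂} {q : N₂ →ₗ[S] N₃}

lemma bhMap_surjective (hp : Function.Injective p) (hpq : Function.Exact p q)
    (hq : Function.Surjective q) (h : ExtVanish S C N₁) : Function.Surjective (bhMap R C q) :=
  fun u => exists_lift_of_extVanish hp hpq hq h u

/-- The dual form of `Tor_1(C, M₃) = 0`. -/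
lemma btMap_injective (hf : Function.Injective f) (hfg : Function.Exact f g)
    (hg : Function.Surjective g) (h : ExtVanish Rᵐᵒᵖ C (CharDual R M₃)) :
    Function.Injective (btMap R S C f) :=
  btMap_injective_iff.2 fun v => exists_lift_of_extVanish (charMap_injective hg)
    (charMap_exact hfg) (charMap_surjective hf) h v

lemma extVanish_charDual_sub (hf : Function.Injective f) (hfg : Function.Exact f g)
    (hg : Function.Surjective g) (h₂ : ExtVanish Rᵐᵒᵖ C (CharDual R M₂))
    (h₃ : ExtVanish Rᵐᵒᵖ C (CharDual R M₃)) : ExtVanish Rᵐᵒᵖ C (CharDual R M₁) :=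
  extVanish_quotient (charMap_injective hg) (charMap_exact hfg) (charMap_surjective hf) h₃ h₂

lemma extVanish_charDual_quotient (hf : Function.Injective f) (hfg : Function.Exact f g)
    (hg : Function.Surjective g) (h₁ : ExtVanish Rᵐᵒᵖ C (CharDual R M₁))
    (h₂ : ExtVanish Rᵐᵒᵖ C (CharDual R M₂)) (hinj : Function.Injective (btMap R S C f)) :
    ExtVanish Rᵐᵒᵖ C (CharDual R M₃) :=
  extVanish_kernel (charMap_injective hg) (charMap_exact hfg) (charMap_surjective hf) h₂ h₁
    (btMap_injective_iff.1 hinj)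

variable (hC : IsFaithfullySemidualizing S R C)
include hC

/-- With `Q` the cokernel of `g`, `C ⊗ Q = 0`, so `Hom_{Rᵒᵖ}(C, Q⁺) = 0`; faithfulness on the right
kills `Q⁺`, hence `Q`. -/
lemma surjective_of_btMap_surjective (h : Function.Surjective (btMap R S C g)) :
    Function.Surjective g := by
  rw [← LinearMap.range_eq_top, ← Submodule.Quotient.subsingleton_iff]
  have : Subsingleton (CharDual R (M₃ ⧸ LinearMap.range g)) := by
    refine hC.right_faithful _ (subsingleton_of_forall_eq 0 fun v => ?_)
    have h0 : charOfHom S (charMap (LinearMap.range g).mkQ ∘ₗ v) = 0 := by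
      ext x
      obtain ⟨y, rfl⟩ := h x
      induction y using BTensor.induction with
      | h c m =>
        have : (LinearMap.range g).mkQ (g m) = 0 := (Submodule.Quotient.mk_eq_zero _).2 ⟨m, rfl⟩
        change v c ((LinearMap.range g).mkQ (g m)) = 0
        rw [this, map_zero]
      | h0 => simp
      | hadd x y hx hy => rw [map_add, map_add, hx, hy, map_add]
    refine LinearMap.ext fun c => charMap_injective (LinearMap.range g).mkQ_surjective
      (CharDual.ext fun m => ?_)
    exact DFunLike.congr_fun h0 (btmul R S c m)
  exact subsingleton_of_charDual (A := R)

lemma subsingleton_of_bTensor (h : Subsingleton (BTensor R S C M₁)) : Subsingleton M₁ := by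
  have : Function.Surjective (0 : M₁ →ₗ[R] M₁) :=
    surjective_of_btMap_surjective hC fun x => ⟨0, Subsingleton.elim _ _⟩
  exact subsingleton_of_forall_eq 0 fun x => (this x).choose_spec.symm

lemma injective_of_bhMap_injective (h : Function.Injective (bhMap R C p)) :
    Function.Injective p := by
  have : Subsingleton (LinearMap.ker p) := by
    refine hC.left_faithful _ (subsingleton_of_forall_eq 0 fun v => ?_)
    have h0 : (show BHom S C N₁ from (LinearMap.ker p).subtype ∘ₗ v) = 0 := by
      refine h (BHom.ext fun c => ?_)
      rw [map_zero]
      exact (v c).2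
    exact LinearMap.ext fun c => Subtype.ext (DFunLike.congr_fun h0 c)
  rw [← LinearMap.ker_eq_bot, ← Submodule.subsingleton_iff_eq_bot]
  exact this

/-- Nothing is known about `Ext¹(C, N₁)` at first. But the counits identify `C ⊗ Hom(C, q)` with
`q`, so faithfulness makes `Hom(C, q)` surjective; the rest is long exact sequences and the five
lemma. -/
lemma IsBass.kernel (hp : Function.Injective p) (hpq : Function.Exact p q)
    (hq : Function.Surjective q) (h₂ : IsBass S R C N₂) (h₃ : IsBass S R C N₃) :
    IsBass S R C N₁ ∧ Function.Surjective (bhMap R C q) := by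
  have hs : Function.Surjective (bhMap R C q) := by
    refine surjective_of_btMap_surjective hC fun y => ?_
    obtain ⟨z, hz⟩ := hq (bcounit S R C N₃ y)
    obtain ⟨x, rfl⟩ := h₂.counit.2 z
    exact ⟨x, h₃.counit.1 (by rw [bcounit_naturality, hz])⟩
  have hi := bhMap_injective (R := R) (C := C) hp
  have he := bhMap_exact (R := R) (C := C) hp hpq
  refine ⟨⟨extVanish_kernel hp hpq hq h₂.ext h₃.ext hs,
    extVanish_charDual_sub hi he hs h₂.tor h₃.tor, ?_⟩, hs⟩
  exact bijective_kernel (bcounit_naturality p) (bcounit_naturality q)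
    (btMap_injective hi he hs h₃.tor) (btMap_exact he hs) hp hpq h₂.counit h₃.counit.1

omit hC in
lemma IsBass.cokernel (hp : Function.Injective p) (hpq : Function.Exact p q)
    (hq : Function.Surjective q) (h₁ : IsBass S R C N₁) (h₂ : IsBass S R C N₂) :
    IsBass S R C N₃ ∧ Function.Surjective (bhMap R C q) := by
  have hs : Function.Surjective (bhMap R C q) := bhMap_surjective hp hpq hq h₁.ext
  have hi := bhMap_injective (R := R) (C := C) hp
  have he := bhMap_exact (R := R) (C := C) hp hpq
  -- The counits identify this map with `p`; its injectivity supplies the vanishing of Tor in degree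
  -- 1.
  have hti : Function.Injective (btMap R S C (bhMap R C p)) := fun x y hxy => h₁.counit.1 (hp (by
    rw [← bcounit_naturality, ← bcounit_naturality, hxy]))
  refine ⟨⟨extVanish_quotient hp hpq hq h₁.ext h₂.ext,
    extVanish_charDual_quotient hi he hs h₁.tor h₂.tor hti, ?_⟩, hs⟩
  exact bijective_cokernel (bcounit_naturality p) (bcounit_naturality q) (btMap_exact he hs)
    (btMap_surjective hs) hpq hq h₁.counit.2 h₂.counit

omit hC in
lemma IsAuslander.kernel (hf : Function.Injective f) (hfg : Function.Exact f g)
    (hg : Function.Surjective g) (h₂ : IsAuslander S R C M₂) (h₃ : IsAuslander S R C M₃) :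
    IsAuslander S R C M₁ ∧ Function.Injective (btMap R S C f) := by
  have hi : Function.Injective (btMap R S C f) := btMap_injective hf hfg hg h₃.tor
  have he := btMap_exact (A := S) (C := C) hfg hg
  have hs := btMap_surjective (R := R) (A := S) (C := C) hg
  have hgs : Function.Surjective (bhMap R C (btMap R S C g)) := fun x => by
    obtain ⟨m, rfl⟩ := h₃.unit.2 x
    obtain ⟨m, rfl⟩ := hg m
    exact ⟨bunit S R C M₂ m, rfl⟩
  refine ⟨⟨extVanish_charDual_sub hf hfg hg h₂.tor h₃.tor,
    extVanish_kernel hi he hs h₂.ext h₃.ext hgs, ?_⟩, hi⟩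
  exact bijective_kernel (fun x => (bunit_naturality f x).symm)
    (fun x => (bunit_naturality g x).symm) hf hfg (bhMap_injective hi) (bhMap_exact hi he)
    h₂.unit h₃.unit.1

/-- Dually to `IsBass.kernel`, the units identify `Hom(C, C ⊗ f)` with `f`, so faithfulness makes `C
⊗ f` injective without assuming `Tor_1(C, M₃) = 0`. -/
lemma IsAuslander.cokernel (hf : Function.Injective f) (hfg : Function.Exact f g)
    (hg : Function.Surjective g) (h₁ : IsAuslander S R C M₁) (h₂ : IsAuslander S R C M₂) :
    IsAuslander S R C M₃ ∧ Function.Injective (btMap R S C f) := by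
  have hi : Function.Injective (btMap R S C f) := by
    refine injective_of_bhMap_injective (R := R) hC fun x y hxy => ?_
    obtain ⟨x, rfl⟩ := h₁.unit.2 x
    obtain ⟨y, rfl⟩ := h₁.unit.2 y
    rw [bunit_naturality, bunit_naturality] at hxy
    rw [hf (h₂.unit.1 hxy)]
  have he := btMap_exact (A := S) (C := C) hfg hg
  have hs := btMap_surjective (R := R) (A := S) (C := C) hg
  refine ⟨⟨extVanish_charDual_quotient hf hfg hg h₁.tor h₂.tor hi,
    extVanish_quotient hi he hs h₁.ext h₂.ext, ?_⟩, hi⟩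
  exact bijective_cokernel (fun x => (bunit_naturality f x).symm)
    (fun x => (bunit_naturality g x).symm) hfg hg (bhMap_exact hi he)
    (bhMap_surjective hi he hs h₁.ext) h₁.unit.2 h₂.unit

/-- By a triangle identity `C ⊗ unit` is inverse to the counit, so the unit is onto by faithfulness.
Vanishing of Tor at its target embeds `C ⊗ ker` in `C ⊗ M₁`, where `C ⊗ unit` kills it; hence the
kernel is zero. -/
lemma IsAuslander.of_bTensor (h : IsBass S R C (BTensor R S C M₁)) : IsAuslander S R C M₁ := by
  have hb : Function.Injective (btMap R S C (bunit S R C M₁)) := fun x y hxy => by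
    rw [← bcounit_btMap_bunit x, hxy, bcounit_btMap_bunit]
  have hs : Function.Surjective (bunit S R C M₁) := surjective_of_btMap_surjective hC fun y =>
    ⟨bcounit S R C _ y, h.counit.1 (bcounit_btMap_bunit _)⟩
  have hu : Function.Bijective (bunit S R C M₁) := by
    refine ⟨?_, hs⟩
    have he := LinearMap.exact_subtype_ker_map (bunit S R C M₁)
    have hi : Function.Injective (btMap R S C (LinearMap.ker (bunit S R C M₁)).subtype) :=
      btMap_injective (Submodule.subtype_injective _) he hs h.tor
    have : Subsingleton (BTensor R S C (LinearMap.ker (bunit S R C M₁))) := by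
      refine subsingleton_of_forall_eq 0 fun x => hi (hb ?_)
      rw [map_zero, map_zero]
      exact (btMap_exact he hs).apply_apply_eq_zero x
    have := subsingleton_of_bTensor hC this
    rw [← LinearMap.ker_eq_bot, ← Submodule.subsingleton_iff_eq_bot]
    exact this
  let e := LinearEquiv.ofBijective _ hu
  exact ⟨extVanish_congr (charCongr e.symm) h.tor, h.ext, hu⟩

lemma IsBass.of_bHom (h : IsAuslander S R C (BHom S C N₁)) : IsBass S R C N₁ := by
  have hi : Function.Injective (bcounit S R C N₁) :=
    injective_of_bhMap_injective (R := R) hC fun x y hxy => by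
      obtain ⟨x, rfl⟩ := h.unit.2 x
      obtain ⟨y, rfl⟩ := h.unit.2 y
      rw [bhMap_bcounit_bunit, bhMap_bcounit_bunit] at hxy
      rw [hxy]
  have hb : Function.Bijective (bcounit S R C N₁) := by
    refine ⟨hi, ?_⟩
    rw [← LinearMap.range_eq_top, ← Submodule.Quotient.subsingleton_iff]
    refine hC.left_faithful _ (subsingleton_of_forall_eq 0 fun v => ?_)
    have he : Function.Exact (bcounit S R C N₁) (LinearMap.range (bcounit S R C N₁)).mkQ :=
      LinearMap.exact_map_mkQ_range _
    -- Since `Ext¹(C, C ⊗ Hom(C, N₁)) = 0`, a map from `C` to the cokernel of the counit lifts to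
    -- some `w : C → N₁`; but `w c` is the counit of `c ⊗ w`, so the map is zero.
    obtain ⟨w, rfl⟩ := bhMap_surjective (R := R) hi he (Submodule.mkQ_surjective _) h.ext v
    refine LinearMap.ext fun c => (he _).2 ⟨btmul R S c w, rfl⟩
  let e := LinearEquiv.ofBijective _ hb
  exact ⟨extVanish_congr e h.ext, h.tor, hb⟩

omit hC

lemma IsBass.congr (e : N₁ ≃ₗ[S] N₂) (h : IsBass S R C N₁) : IsBass S R C N₂ :=
  ⟨extVanish_congr e h.ext, extVanish_congr (charCongr (bhCongr e)) h.tor,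
    (Function.Bijective.of_comp_iff _ (btCongr (R := R) (C := C) (bhCongr e)).bijective).1
      (by
        have : bcounit S R C N₂ ∘ btCongr (R := R) (C := C) (bhCongr e) = e ∘ bcounit S R C N₁ :=
          funext (bcounit_naturality e.toLinearMap)
        rw [this]
        exact e.bijective.comp h.counit)⟩

lemma IsAuslander.congr (e : M₁ ≃ₗ[R] M₂) (h : IsAuslander S R C M₁) : IsAuslander S R C M₂ :=
  ⟨extVanish_congr (charCongr e) h.tor, extVanish_congr (btCongr e) h.ext,
    (Function.Bijective.of_comp_iff _ e.bijective).1
      ((bhCongr (R := R) (C := C) (btCongr (S := S) e)).bijective.comp h.unit)⟩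

end ShortExact

end Classes

/-! ### Splitting and splicing finite resolutions. -/

section Resolutions

variable {A : Type u} [Ring A] {P : ModuleCat.{u} A → Prop} {M M' : Type u} [AddCommGroup M]
  [Module A M] [AddCommGroup M'] [Module A M'] {k : ℕ}

lemma HasCoresolution.congr (e : M ≃ₗ[A] M') (h : HasCoresolution P M k) :
    HasCoresolution P M' k := by
  obtain ⟨I, ε, d, hP, h0, hε, hεd, hd⟩ := h
  refine ⟨I, ε ∘ₗ e.symm.toLinearMap, d, hP, h0, hε.comp e.symm.injective, fun x => ?_, hd⟩
  rw [hεd x]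
  exact (e.symm.surjective.exists (p := fun y => ε y = x))

lemma HasResolution.congr (e : M ≃ₗ[A] M') (h : HasResolution P M k) : HasResolution P M' k := by
  obtain ⟨F, ε, d, hP, h0, hε, hεd, hd⟩ := h
  refine ⟨F, e.toLinearMap ∘ₗ ε, d, hP, h0, e.surjective.comp hε, fun x => ?_, hd⟩
  rw [← hεd x]
  simp

lemma HasCoresolution.exists_equiv (h : HasCoresolution P M 0) :
    ∃ I : ModuleCat.{u} A, P I ∧ Nonempty (M ≃ₗ[A] I) := by
  obtain ⟨I, ε, d, hP, h0, hε, hεd, hd⟩ := h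
  have := h0 1 one_pos
  exact ⟨I 0, hP 0 le_rfl, ⟨LinearEquiv.ofBijective ε
    ⟨hε, fun x => (hεd x).1 (Subsingleton.elim (α := I 1) _ _)⟩⟩⟩

lemma HasResolution.exists_equiv (h : HasResolution P M 0) :
    ∃ F : ModuleCat.{u} A, P F ∧ Nonempty (F ≃ₗ[A] M) := by
  obtain ⟨F, ε, d, hP, h0, hε, hεd, hd⟩ := h
  have := h0 1 one_pos
  refine ⟨F 0, hP 0 le_rfl, ⟨LinearEquiv.ofBijective ε ⟨?_, hε⟩⟩⟩
  rw [injective_iff_map_eq_zero]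
  intro x hx
  obtain ⟨y, rfl⟩ := (hεd x).1 hx
  rw [Subsingleton.elim (α := F 1) y 0, map_zero]

lemma HasCoresolution.of_equiv {I : Type u} [AddCommGroup I] [Module A I]
    (hI : P (ModuleCat.of A I)) (e : M ≃ₗ[A] I) :
    HasCoresolution P M 0 := by
  refine ⟨fun i => Nat.casesOn i (ModuleCat.of A I) fun _ => ModuleCat.of A PUnit.{u + 1}, e.toLinearMap,
    fun _ => 0, ?_, ?_, e.injective,
    fun x => ⟨fun _ => ?_, fun _ => rfl⟩,
    fun i x => ⟨fun _ => ⟨0, Subsingleton.elim (α := PUnit.{u + 1}) _ _⟩, fun _ => rfl⟩⟩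
  · rintro (_ | i) hi
    · exact hI
    · omega
  · rintro (_ | i) hi
    · omega
    · exact inferInstanceAs (Subsingleton PUnit.{u + 1})
  · exact ⟨e.symm x, e.apply_symm_apply x⟩

lemma HasResolution.of_equiv {F : Type u} [AddCommGroup F] [Module A F]
    (hF : P (ModuleCat.of A F)) (e : F ≃ₗ[A] M) :
    HasResolution P M 0 := by
  refine ⟨fun i => Nat.casesOn i (ModuleCat.of A F) fun _ => ModuleCat.of A PUnit.{u + 1}, e.toLinearMap,
    fun _ => 0, ?_, ?_, e.surjective, fun x => ⟨fun h => ⟨0, ?_⟩, ?_⟩,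
    fun i x => ⟨fun _ => ⟨0, Subsingleton.elim (α := PUnit.{u + 1}) _ _⟩, fun _ => rfl⟩⟩
  · rintro (_ | i) hi
    · exact hF
    · omega
  · rintro (_ | i) hi
    · omega
    · exact inferInstanceAs (Subsingleton PUnit.{u + 1})
  · exact (e.map_eq_zero_iff.1 h).symm
  · rintro ⟨y, rfl⟩
    exact map_zero e

lemma HasCoresolution.exists_cosyzygy (h : HasCoresolution P M (k + 1)) :
    ∃ (I K : ModuleCat.{u} A) (f : M →ₗ[A] I) (g : I →ₗ[A] K), P I ∧ Function.Injective f ∧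
      Function.Exact f g ∧ Function.Surjective g ∧ HasCoresolution P K k := by
  obtain ⟨I, ε, d, hP, h0, hε, hεd, hd⟩ := h
  refine ⟨I 0, ModuleCat.of A (LinearMap.range (d 0)), ε, (d 0).rangeRestrict, hP 0 (by omega), hε,
    fun x => ?_, LinearMap.surjective_rangeRestrict _, fun i => I (i + 1),
    (LinearMap.range (d 0)).subtype, fun i => d (i + 1), fun i hi => hP _ (by omega),
    fun i hi => h0 _ (by omega), Submodule.subtype_injective _, fun x => ?_, fun i => hd _⟩
  · rw [← hεd x]
    exact Subtype.ext_iff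
  · rw [hd 0 x]
    exact ⟨fun h => ⟨⟨x, h⟩, rfl⟩, fun ⟨y, hy⟩ => hy ▸ y.2⟩

lemma HasResolution.exists_syzygy (h : HasResolution P M (k + 1)) :
    ∃ (F K : ModuleCat.{u} A) (f : K →ₗ[A] F) (g : F →ₗ[A] M), P F ∧ Function.Injective f ∧
      Function.Exact f g ∧ Function.Surjective g ∧ HasResolution P K k := by
  obtain ⟨F, ε, d, hP, h0, hε, hεd, hd⟩ := h
  refine ⟨F 0, ModuleCat.of A (LinearMap.ker ε), (LinearMap.ker ε).subtype, ε, hP 0 (by omega),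
    Submodule.subtype_injective _, LinearMap.exact_subtype_ker_map ε, hε, fun i => F (i + 1),
    (d 0).codRestrict _ fun x => hεd.apply_apply_eq_zero x, fun i => d (i + 1),
    fun i hi => hP _ (by omega), fun i hi => h0 _ (by omega), ?_, fun x => ?_, fun i => hd _⟩
  · rintro ⟨x, hx⟩
    obtain ⟨y, rfl⟩ := (hεd x).1 hx
    exact ⟨y, rfl⟩
  · rw [← hd 0 x]
    exact Subtype.ext_iff

lemma HasCoresolution.cons {I K : Type u} [AddCommGroup I] [Module A I] [AddCommGroup K]
    [Module A K] {f : M →ₗ[A] I} {g : I →ₗ[A] K} (hI : P (ModuleCat.of A I))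
    (hf : Function.Injective f) (hfg : Function.Exact f g) (hg : Function.Surjective g)
    (hK : HasCoresolution P K k) : HasCoresolution P M (k + 1) := by
  obtain ⟨J, ε, d, hP, h0, hε, hεd, hd⟩ := hK
  refine ⟨fun i => Nat.casesOn i (ModuleCat.of A I) J, f, fun i => Nat.casesOn i (ε ∘ₗ g) d,
    ?_, ?_, hf, fun x => ?_, ?_⟩
  · rintro (_ | i) hi
    · exact hI
    · exact hP i (by omega)
  · rintro (_ | i) hi
    · omega
    · exact h0 i (by omega)
  · rw [← hfg x]
    exact map_eq_zero_iff ε hε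
  · rintro (_ | i)
    · intro x
      exact (hεd x).trans (hg.exists (p := fun y => ε y = x))
    · exact hd i

lemma HasResolution.cons {F K : Type u} [AddCommGroup F] [Module A F] [AddCommGroup K]
    [Module A K] {f : K →ₗ[A] F} {g : F →ₗ[A] M} (hF : P (ModuleCat.of A F))
    (hf : Function.Injective f) (hfg : Function.Exact f g) (hg : Function.Surjective g)
    (hK : HasResolution P K k) : HasResolution P M (k + 1) := by
  obtain ⟨J, ε, d, hP, h0, hε, hεd, hd⟩ := hK
  refine ⟨fun i => Nat.casesOn i (ModuleCat.of A F) J, g, fun i => Nat.casesOn i (f ∘ₗ ε) d,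
    ?_, ?_, hg, fun x => ?_, ?_⟩
  · rintro (_ | i) hi
    · exact hF
    · exact hP i (by omega)
  · rintro (_ | i) hi
    · omega
    · exact h0 i (by omega)
  · exact (hfg x).trans (hε.exists (p := fun y => f y = x))
  · rintro (_ | i)
    · intro x
      refine Iff.trans ?_ (hεd x)
      exact map_eq_zero_iff f hf
    · exact hd i

lemma coresolutionDim_congr {B : Type u} [Ring B] {Q : ModuleCat.{u} B → Prop} {N : Type u}
    [AddCommGroup N] [Module B N] (h : ∀ k, HasCoresolution P M k ↔ HasCoresolution Q N k) :
    coresolutionDim P M = coresolutionDim Q N := by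
  simp only [coresolutionDim, h]

lemma resolutionDim_congr {B : Type u} [Ring B] {Q : ModuleCat.{u} B → Prop} {N : Type u}
    [AddCommGroup N] [Module B N] (h : ∀ k, HasResolution P M k ↔ HasResolution Q N k) :
    resolutionDim P M = resolutionDim Q N := by
  simp only [resolutionDim, h]

end Resolutions

/-! ### Transport of resolutions through the equivalence. -/

section Foxby

variable {S R : Type u} [Ring S] [Ring R] {C : Type u} [AddCommGroup C] [Module S C]
  [Module Rᵐᵒᵖ C] [SMulCommClass S Rᵐᵒᵖ C] {n k : ℕ}

lemma IsFpFlat.congr {Y Y' : Type u} [AddCommGroup Y] [Module R Y] [AddCommGroup Y']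
    [Module R Y'] (e : Y ≃ₗ[R] Y') (hY : IsFpFlat n R Y) : IsFpFlat n R Y' := by
  intro K L _ _ _ _ i hK hL hi
  rw [injective_iff_map_eq_zero]
  refine fun x hx => eq_zero_of_char fun φ => ?_
  -- `Y'⁺` is `fp_n`-injective, so every character of `K ⊗ Y'` extends along `K ⊗ Y' → L ⊗ Y'`.
  obtain ⟨w, hw⟩ := hY.charDual.congr (charCongr e) K L i hK hL hi (homOfChar φ)
  have : φ = (charOfHom ℤ w).comp (bTensorMap R Y' i).toAddMonoidHom :=
    BTensor.addHom_ext fun c m => (DFunLike.congr_fun (LinearMap.congr_fun hw c) m).symm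
  rw [this]
  change charOfHom ℤ w (bTensorMap R Y' i x) = 0
  rw [hx, map_zero]

lemma IsCFpInjective.isAuslander (hC : IsSemidualizing S R C) {M : Type u} [AddCommGroup M]
    [Module R M] (hM : IsCFpInjective n S R C M) :
    IsAuslander S R C M ∧ IsFpInjective n S (BTensor R S C M) := by
  obtain ⟨X, hX, ⟨e⟩⟩ := hM
  have hB := hX.isBass hC
  exact ⟨hB.bHom.congr e.symm, hX.congr (hB.equiv.symm.trans (btCongr e.symm))⟩

lemma IsCFpFlat.isBass (hC : IsSemidualizing S R C) {N : Type u} [AddCommGroup N]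
    [Module S N] (hN : IsCFpFlat n S R C N) :
    IsBass S R C N ∧ IsFpFlat n R (BHom S C N) := by
  obtain ⟨Y, hY, ⟨e⟩⟩ := hN
  have hA := hY.isAuslander hC
  exact ⟨hA.bTensor.congr e.symm, hY.congr (hA.equiv.trans (bhCongr e.symm))⟩

variable (hC : IsFaithfullySemidualizing S R C)
include hC

/-- Induction on the length, splitting off the first term: the cosyzygy is Bass, hence so is the
kernel `N`, and `Hom_S(C, -)` keeps the short exact sequence exact. The three analogues below follow
the same pattern. -/
lemma HasCoresolution.bHom {N : Type u} [AddCommGroup N] [Module S N]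
    (h : HasCoresolution (fun I : ModuleCat.{u} S => IsFpInjective n S I) N k) :
    IsBass S R C N ∧
      HasCoresolution (fun I : ModuleCat.{u} R => IsCFpInjective n S R C I) (BHom S C N) k := by
  induction k generalizing N with
  | zero =>
    obtain ⟨I, hI, ⟨e⟩⟩ := h.exists_equiv
    exact ⟨(IsFpInjective.isBass hC.toIsSemidualizing hI).congr e.symm,
      .of_equiv (I := BHom S C I) ⟨I, hI, ⟨LinearEquiv.refl R (BHom S C I)⟩⟩
        (bhCongr e : BHom S C N ≃ₗ[R] BHom S C I)⟩
  | succ k ih =>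
    obtain ⟨I, K, f, g, hI, hf, hfg, hg, hK⟩ := h.exists_cosyzygy
    obtain ⟨hKB, hKc⟩ := ih hK
    obtain ⟨hN, hs⟩ := IsBass.kernel hC hf hfg hg
      (IsFpInjective.isBass hC.toIsSemidualizing hI) hKB
    exact ⟨hN, .cons (I := BHom S C I) ⟨I, hI, ⟨LinearEquiv.refl R (BHom S C I)⟩⟩
      (bhMap_injective hf) (bhMap_exact hf hfg) hs hKc⟩

lemma HasCoresolution.bTensor {M : Type u} [AddCommGroup M] [Module R M]
    (h : HasCoresolution (fun I : ModuleCat.{u} R => IsCFpInjective n S R C I) M k) :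
    IsAuslander S R C M ∧
      HasCoresolution (fun I : ModuleCat.{u} S => IsFpInjective n S I) (BTensor R S C M) k := by
  induction k generalizing M with
  | zero =>
    obtain ⟨I, hI, ⟨e⟩⟩ := h.exists_equiv
    obtain ⟨hIA, hIX⟩ := IsCFpInjective.isAuslander hC.toIsSemidualizing hI
    exact ⟨hIA.congr e.symm, .of_equiv (I := BTensor R S C I) hIX (btCongr e)⟩
  | succ k ih =>
    obtain ⟨I, K, f, g, hI, hf, hfg, hg, hK⟩ := h.exists_cosyzygy
    obtain ⟨hKA, hKc⟩ := ih hK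
    obtain ⟨hIA, hIX⟩ := IsCFpInjective.isAuslander hC.toIsSemidualizing hI
    obtain ⟨hM, hi⟩ := IsAuslander.kernel hf hfg hg hIA hKA
    exact ⟨hM, .cons hIX hi (btMap_exact hfg hg) (btMap_surjective hg) hKc⟩

lemma HasResolution.bTensor {M : Type u} [AddCommGroup M] [Module R M]
    (h : HasResolution (fun F : ModuleCat.{u} R => IsFpFlat n R F) M k) :
    IsAuslander S R C M ∧
      HasResolution (fun F : ModuleCat.{u} S => IsCFpFlat n S R C F) (BTensor R S C M) k := by
  induction k generalizing M with
  | zero =>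
    obtain ⟨F, hF, ⟨e⟩⟩ := h.exists_equiv
    exact ⟨(IsFpFlat.isAuslander hC.toIsSemidualizing hF).congr e,
      .of_equiv (F := BTensor R S C F) ⟨F, hF, ⟨LinearEquiv.refl _ _⟩⟩ (btCongr e)⟩
  | succ k ih =>
    obtain ⟨F, K, f, g, hF, hf, hfg, hg, hK⟩ := h.exists_syzygy
    obtain ⟨hKA, hKr⟩ := ih hK
    obtain ⟨hM, hi⟩ := IsAuslander.cokernel hC hf hfg hg hKA
      (IsFpFlat.isAuslander hC.toIsSemidualizing hF)
    exact ⟨hM, .cons ⟨F, hF, ⟨LinearEquiv.refl _ _⟩⟩ hi (btMap_exact hfg hg) (btMap_surjective hg) hKr⟩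

lemma HasResolution.bHom {N : Type u} [AddCommGroup N] [Module S N]
    (h : HasResolution (fun F : ModuleCat.{u} S => IsCFpFlat n S R C F) N k) :
    IsBass S R C N ∧
      HasResolution (fun F : ModuleCat.{u} R => IsFpFlat n R F) (BHom S C N) k := by
  induction k generalizing N with
  | zero =>
    obtain ⟨F, hF, ⟨e⟩⟩ := h.exists_equiv
    obtain ⟨hFB, hFY⟩ := IsCFpFlat.isBass hC.toIsSemidualizing hF
    exact ⟨hFB.congr e, .of_equiv (F := BHom S C F) hFY
      (bhCongr e : BHom S C F ≃ₗ[R] BHom S C N)⟩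
  | succ k ih =>
    obtain ⟨F, K, f, g, hF, hf, hfg, hg, hK⟩ := h.exists_syzygy
    obtain ⟨hKB, hKr⟩ := ih hK
    obtain ⟨hFB, hFY⟩ := IsCFpFlat.isBass hC.toIsSemidualizing hF
    obtain ⟨hN, hs⟩ := IsBass.cokernel hf hfg hg hKB hFB
    exact ⟨hN, .cons (F := BHom S C F) hFY (bhMap_injective hf)
      (bhMap_exact hf hfg) hs hKr⟩

end Foxby

end FpDim

theorem proposition4p7 (R S : Type u) [Ring R] [Ring S] (C : Type u) [AddCommGroup C] [Module S C]
    [Module Rᵐᵒᵖ C] [SMulCommClass S Rᵐᵒᵖ C] (hC : FpDim.IsFaithfullySemidualizing S R C)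
    (n : ℕ) (hn : 1 ≤ n)
    (M : Type u) [AddCommGroup M] [Module R M] (N : Type u) [AddCommGroup N] [Module S N] :
    FpDim.fpId n S N = FpDim.cFpId n S R C (FpDim.BHom S C N) ∧
    FpDim.fpFd n R M = FpDim.cFpFd n S R C (FpDim.BTensor R S C M) ∧
    FpDim.cFpId n S R C M = FpDim.fpId n S (FpDim.BTensor R S C M) ∧
    FpDim.cFpFd n S R C N = FpDim.fpFd n R (FpDim.BHom S C N) := by
  refine ⟨FpDim.coresolutionDim_congr fun k => ⟨fun h => (h.bHom hC).2, fun h => ?_⟩,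
    FpDim.resolutionDim_congr fun k => ⟨fun h => (h.bTensor hC).2, fun h => ?_⟩,
    FpDim.coresolutionDim_congr fun k => ⟨fun h => (h.bTensor hC).2, fun h => ?_⟩,
    FpDim.resolutionDim_congr fun k => ⟨fun h => (h.bHom hC).2, fun h => ?_⟩⟩
  -- Each converse applies the other functor; the unit or counit then returns to the original
  -- module.
  · obtain ⟨hA, hc⟩ := h.bTensor hC
    exact hc.congr (FpDim.IsBass.of_bHom hC hA).equiv
  · obtain ⟨hB, hr⟩ := h.bHom hC
    exact hr.congr (FpDim.IsAuslander.of_bTensor hC hB).equiv.symm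
  · obtain ⟨hB, hc⟩ := h.bHom hC
    exact hc.congr (FpDim.IsAuslander.of_bTensor hC hB).equiv.symm
  · obtain ⟨hA, hr⟩ := h.bTensor hC
    exact hr.congr (FpDim.IsBass.of_bHom hC hA).equiv
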